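/- Setting. Let $K$ be a field of characteristic $0$ with an endomorphism $\sigma$, and let $K\{Y\}=K[y_j^{(i)}: 1\le j\le n,\ i\ge 0]$ be the ring of difference polynomials, with $\sigma$ extended by $\sigma(y_j^{(i)})=y_j^{(i+1)}$. A $\sigma$-prime ideal is a prime ideal $\mathfrak q$ such that $a\in\mathfrak q\iff\sigma(a)\in\mathfrak q$. Let $F=\{f_1,\dots,f_r\}\subset K\{Y\}$, let $e$ be the largest $i$ such that some $y_j^{(i)}$ occurs in some $f_l$, and assume $e\ge 1$. Let $\mathfrak p$ be minimal among the $\sigma$-prime ideals of $K\{Y\}$ that contain the difference ideal $[F]$ generated by $F$, and let $\kappa$ be its residue class field. Write $f_l^{(j)}=\sigma^j(f_l)$ and $F^{(j)}=(f_1^{(j)},\dots,f_r^{(j)})$, $Y^{(j)}=(y_1^{(j)},\dots,y_n^{(j)})$. For $m\ge0$ let $A_m=K[y_j^{(i)}: i\le m]$ and let $B_m$ be the localization of $A_m$ at $A_m\cap\mathfrak p$. For $k\ge 0$ let $\Delta_k$ be the ideal of $B_{k-1+e}$ generated by all $f_l^{(j)}$ with $1\le l\le r$, $0\le j<k$ (so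 $\Delta_0=(0)$), and let $\Delta$ be the difference ideal generated by $F$ in $K\{Y\}_{\mathfrak p}$. Assume that $F$ is quasi-prime at $\mathfrak p$: every $\Delta_k$ ($k\ge0$) is prime, and $\Delta$ is reflexive ($\sigma(a)\in\Delta$ implies $a\in\Delta$). Let $\kappa(\Delta_k)=\mathrm{Frac}(B_{k-1+e}/\Delta_k)$. Consider the Jacobian matrices $$J_k=\frac{\partial(F,\dots,F^{(k-1)})}{\partial(Y,\dots,Y^{(k-1+e)})},\qquad J_{k,i}=\frac{\partial(F^{(i-e+1)},\dots,F^{(i-e+k)})}{\partial(Y^{(i+1)},\dots,Y^{(i+k)})}\quad(i\ge e-1),$$ and assume that, for all $k\ge 0$ and $i\ge e-1$, the rank of $J_k$ over $\kappa(\Delta_{k+s})$ and the rank of $J_{k,i}$ over $\kappa(\Delta_{i-e+1+k+s})$ do not depend on $s\ge0$. Let $\psi(k)=\mathrm{trdeg}_K\,\kappa(\Delta_k)$; for large $k$ one has $\psi(k)=dk+s$ with $d\in\mathbb N$, $s\in\mathbb Z$. The quasi regularity degree $\rho$ is the least $k_0\in\mathbb N$ such that $\psi(k)=dk+s$ for all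 $k\ge k_0$. Let $\mu_k=\dim_\kappa\ker(J_{k,i}^{\,t})$ (this does not depend on $i\ge e-1$, so one may take $i=e-1$); for large $k$ one has $\mu_k=(d+r-n)k+a$ with $a\in\mathbb Z$. The difference index $\omega$ is the least $k_0\in\mathbb N$ such that $\mu_k=(d+r-n)k+a$ for all $k\ge k_0$. Theorem. (1) For every $i\ge e-1$ with $i+\omega\ge\rho+e-1$, $$\Delta_{i-e+1+\omega}\cap B_i=\Delta\cap B_i\quad\text{in } B_i.$$ (2) For every $i\ge e-1$ the number $h_i=\min\{h\in\mathbb N:\Delta_{i-e+1+h}\cap B_i=\Delta\cap B_i\}$ exists, and if $i+\omega\ge\rho+e-1$ and $i+h_i\ge\rho+e-1$, then $\omega=h_i$. -/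

import Mathlib

noncomputable section

namespace DiffSys

open MvPolynomial

/-! ### Difference ideals -/

section Ideals

variable {R : Type*} [CommRing R]

/-- `I` is a difference ideal of the difference ring `(R, τ)`. -/
def IsSigmaIdeal (τ : R →+* R) (I : Ideal R) : Prop :=
  ∀ a, a ∈ I → τ a ∈ I

/-- The ideal `I` of the difference ring `(R, τ)` is reflexive. -/
def IsReflexive (τ : R →+* R) (I : Ideal R) : Prop :=
  ∀ a, τ a ∈ I → a ∈ I

/-- `I` is a `σ`-prime ideal of `(R, τ)`: a reflexive difference ideal which is prime. -/
structure IsSigmaPrime (τ : R →+* R) (I : Ideal R) : Prop where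
  isSigmaIdeal : IsSigmaIdeal τ I
  isReflexive : IsReflexive τ I
  isPrime : I.IsPrime

/-- The difference ideal `[S]` of `(R, τ)` generated by `S`; it is spanned by all transforms of
elements of `S`. -/
def sigmaSpan (τ : R →+* R) (S : Set R) : Ideal R :=
  Ideal.span {x | ∃ s ∈ S, ∃ j : ℕ, x = τ^[j] s}

/-- `[S]` is indeed the smallest difference ideal that contains `S`. -/
theorem sigmaSpan_isLeast (τ : R →+* R) (S : Set R) :
    IsLeast {I : Ideal R | S ⊆ I ∧ IsSigmaIdeal τ I} (sigmaSpan τ S) := by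
  refine ⟨⟨fun s hs => Ideal.subset_span ⟨s, hs, 0, rfl⟩, ?_⟩, ?_⟩
  · intro a ha
    have h : sigmaSpan τ S ≤ (sigmaSpan τ S).comap τ := by
      refine Ideal.span_le.2 ?_
      rintro _ ⟨s, hs, j, rfl⟩
      exact Ideal.subset_span ⟨s, hs, j + 1, by rw [Function.iterate_succ_apply']⟩
    exact h ha
  · rintro I ⟨hS, hI⟩
    refine Ideal.span_le.2 ?_
    rintro _ ⟨s, hs, j, rfl⟩
    induction j with
    | zero => exact hS hs
    | succ j ih => rw [Function.iterate_succ_apply']; exact hI _ ih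

theorem IsSigmaPrime.eq_comap {τ : R →+* R} {I : Ideal R} (h : IsSigmaPrime τ I) :
    I = I.comap τ :=
  le_antisymm (fun a ha => h.isSigmaIdeal a ha) (fun a ha => h.isReflexive a ha)

/-- The extension of `τ` to the localization `R_p` at a `σ`-prime ideal `p`. -/
def locSigma (τ : R →+* R) (p : Ideal R) [p.IsPrime] (hp : IsSigmaPrime τ p) :
    Localization.AtPrime p →+* Localization.AtPrime p :=
  Localization.localRingHom p p τ hp.eq_comap

end Ideals

/-! ### Difference polynomials -/

/-- The ring `K{y_1, …, y_n}` of difference polynomials: the variable `(j, i)` is the `i`-th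
transform `y_j^{(i)}`. -/
abbrev DiffPoly (n : ℕ) (K : Type*) [Field K] : Type _ :=
  MvPolynomial (Fin n × ℕ) K

/-- `A_m`, the polynomial ring over `K` in the variables `y_j^{(i)}` with `i ≤ m`. -/
abbrev A (n : ℕ) (K : Type*) [Field K] (m : ℕ) : Type _ :=
  MvPolynomial {v : Fin n × ℕ // v.2 ≤ m} K

variable {K : Type*} [Field K] {n r : ℕ}

/-- The endomorphism of `K{y_1, …, y_n}` which extends `σ : K → K` and sends `y_j^{(i)}` to
`y_j^{(i+1)}`. -/
def shift (σ : K →+* K) : DiffPoly n K →+* DiffPoly n K :=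
  eval₂Hom (C.comp σ) (fun v => X (v.1, v.2 + 1))

/-- The inclusion of `A_m` in `K{y_1, …, y_n}`. -/
def inclA (m : ℕ) : A n K m →+* DiffPoly n K :=
  (rename (R := K) (Subtype.val : {v : Fin n × ℕ // v.2 ≤ m} → Fin n × ℕ)).toRingHom

/-- The inclusion of `A_i` in `A_m` for `i ≤ m`. -/
def transA {i m : ℕ} (h : i ≤ m) : A n K i →+* A n K m :=
  (rename (R := K) (fun v : {v : Fin n × ℕ // v.2 ≤ i} =>
    (⟨v.1, v.2.trans h⟩ : {v : Fin n × ℕ // v.2 ≤ m}))).toRingHom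

/-- A difference polynomial of order at most `m`, seen as an element of `A_m`. (As a total map this
is the left inverse of `inclA m` that sends the variables of order greater than `m` to `0`; it is
only used for polynomials that lie in `A_m`, see `inclA_toA`.) -/
def toA (m : ℕ) : DiffPoly n K →+* A n K m :=
  (killCompl (R := K) (f := (Subtype.val : {v : Fin n × ℕ // v.2 ≤ m} → Fin n × ℕ))
    Subtype.val_injective).toRingHom

theorem inclA_toA (m : ℕ) (g : DiffPoly n K) (hg : ∀ v ∈ g.vars, v.2 ≤ m) :
    inclA m (toA m g) = g := by
  have h : g ∈ supported K {v : Fin n × ℕ | v.2 ≤ m} := mem_supported.2 hg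
  rw [supported_eq_range_rename] at h
  obtain ⟨q, rfl⟩ := h
  exact congrArg (rename (R := K) Subtype.val)
    (killCompl_rename_app (R := K) Subtype.val_injective q)

theorem inclA_comp_transA {i m : ℕ} (h : i ≤ m) :
    (inclA m).comp (transA h) = (inclA i : A n K i →+* DiffPoly n K) := by
  ext x
  · simp [inclA, transA]
  · simp [inclA, transA]

/-- The largest order `e` of a transform that occurs in the system `f_1, …, f_r`. -/
def maxOrd (f : Fin r → DiffPoly n K) : ℕ :=
  Finset.univ.sup fun l => (f l).vars.sup Prod.snd

/-! ### The local rings `B_m` and the ideals `Δ_k`, `Δ` -/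

/-- `B_m`, the localization of `A_m` at `A_m ∩ p`. -/
abbrev B (p : Ideal (DiffPoly n K)) [p.IsPrime] (m : ℕ) : Type _ :=
  Localization.AtPrime (p.comap (inclA m))

/-- The inclusion `B_i → B_m` for `i ≤ m`. -/
def transB (p : Ideal (DiffPoly n K)) [p.IsPrime] {i m : ℕ} (h : i ≤ m) : B p i →+* B p m :=
  Localization.localRingHom (p.comap (inclA i)) (p.comap (inclA m)) (transA h)
    (by rw [Ideal.comap_comap, inclA_comp_transA])

/-- The inclusion `B_i → K{y_1, …, y_n}_p`. -/
def inclB (p : Ideal (DiffPoly n K)) [p.IsPrime] (i : ℕ) : B p i →+* Localization.AtPrime p :=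
  Localization.localRingHom (p.comap (inclA i)) p (inclA i) rfl

/-- The ideal of `B_m` generated by the transforms `f_l^{(j)}` with `j < k`
(meaningful when these lie in `A_m`, that is, for `k - 1 + e ≤ m`). -/
def deltaIn (σ : K →+* K) (f : Fin r → DiffPoly n K) (p : Ideal (DiffPoly n K)) [p.IsPrime]
    (m k : ℕ) : Ideal (B p m) :=
  Ideal.span {x | ∃ l : Fin r, ∃ j < k, x = algebraMap (A n K m) (B p m)
    (toA m ((shift σ)^[j] (f l)))}

/-- `Δ_k`, an ideal of `B_{k-1+e}`. -/
def Delta (σ : K →+* K) (f : Fin r → DiffPoly n K) (p : Ideal (DiffPoly n K)) [p.IsPrime]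
    (k : ℕ) : Ideal (B p (k + maxOrd f - 1)) :=
  deltaIn σ f p (k + maxOrd f - 1) k

/-- `Δ`, the difference ideal generated by `f_1, …, f_r` in the localization
`K{y_1, …, y_n}_p`. -/
def DeltaInf (σ : K →+* K) (f : Fin r → DiffPoly n K) (p : Ideal (DiffPoly n K)) [p.IsPrime]
    (hp : IsSigmaPrime (shift σ) p) : Ideal (Localization.AtPrime p) :=
  sigmaSpan (locSigma (shift σ) p hp)
    (Set.range fun l => algebraMap (DiffPoly n K) (Localization.AtPrime p) (f l))

/-- `Δ_{i-e+1+h} ∩ B_i`, for `i ≥ e - 1`. Here `Δ_{i-e+1+h}` is an ideal of `B_{i+h}`, as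
`(i - e + 1 + h) - 1 + e = i + h`. -/
def deltaCap (σ : K →+* K) (f : Fin r → DiffPoly n K) (p : Ideal (DiffPoly n K)) [p.IsPrime]
    (i h : ℕ) : Ideal (B p i) :=
  (deltaIn σ f p (i + h) (i + 1 - maxOrd f + h)).comap (transB p (Nat.le_add_right i h))

/-- `Δ ∩ B_i`. -/
def deltaInfCap (σ : K →+* K) (f : Fin r → DiffPoly n K) (p : Ideal (DiffPoly n K)) [p.IsPrime]
    (hp : IsSigmaPrime (shift σ) p) (i : ℕ) : Ideal (B p i) :=
  (DeltaInf σ f p hp).comap (inclB p i)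

/-- The system `f_1, …, f_r` is quasi-prime at `p`. -/
structure IsQuasiPrime (σ : K →+* K) (f : Fin r → DiffPoly n K) (p : Ideal (DiffPoly n K))
    [p.IsPrime] (hp : IsSigmaPrime (shift σ) p) : Prop where
  prime_delta : ∀ k, (Delta σ f p k).IsPrime
  reflexive : IsReflexive (locSigma (shift σ) p hp) (DeltaInf σ f p hp)

/-! ### Residue class fields and Jacobian matrices -/

/-- `κ(Δ_k)`, the residue class field of `Δ_k` in `B_{k-1+e}`: the fraction field of the
quotient. -/
abbrev kappaDelta (σ : K →+* K) (f : Fin r → DiffPoly n K) (p : Ideal (DiffPoly n K))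
    [p.IsPrime] (k : ℕ) : Type _ :=
  FractionRing (B p (k + maxOrd f - 1) ⧸ Delta σ f p k)

/-- The canonical map `A_{k-1+e} → κ(Δ_k)`, applied to difference polynomials which lie in
`A_{k-1+e}`. -/
def toKappaDelta (σ : K →+* K) (f : Fin r → DiffPoly n K) (p : Ideal (DiffPoly n K))
    [p.IsPrime] (k : ℕ) : DiffPoly n K →+* kappaDelta σ f p k :=
  (algebraMap (B p (k + maxOrd f - 1)) (kappaDelta σ f p k)).comp
    ((algebraMap (A n K (k + maxOrd f - 1)) (B p (k + maxOrd f - 1))).comp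
      (toA (k + maxOrd f - 1)))

/-- `κ`, the residue class field of `p`. -/
abbrev kappa (p : Ideal (DiffPoly n K)) : Type _ := FractionRing (DiffPoly n K ⧸ p)

/-- The canonical map `K{y_1, …, y_n} → κ`. -/
def toKappa (p : Ideal (DiffPoly n K)) : DiffPoly n K →+* kappa p :=
  (algebraMap (DiffPoly n K ⧸ p) (kappa p)).comp (Ideal.Quotient.mk p)

/-- The Jacobian matrix `J_k` of `F, F^{(1)}, …, F^{(k-1)}` with respect to
`Y, Y^{(1)}, …, Y^{(k-1+e)}`. -/
def jac (σ : K →+* K) (f : Fin r → DiffPoly n K) (k : ℕ) :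
    Matrix (Fin k × Fin r) (Fin (k + maxOrd f) × Fin n) (DiffPoly n K) :=
  Matrix.of fun a b => pderiv (b.2, (b.1 : ℕ)) ((shift σ)^[(a.1 : ℕ)] (f a.2))

/-- The pseudo-Jacobian matrix `J_{k,i}` of `F^{(i-e+1)}, …, F^{(i-e+k)}` with respect to
`Y^{(i+1)}, …, Y^{(i+k)}`, for `i ≥ e - 1`. -/
def pseudoJac (σ : K →+* K) (f : Fin r → DiffPoly n K) (k i : ℕ) :
    Matrix (Fin k × Fin r) (Fin k × Fin n) (DiffPoly n K) :=
  Matrix.of fun a b =>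
    pderiv (b.2, i + 1 + (b.1 : ℕ)) ((shift σ)^[i + 1 - maxOrd f + (a.1 : ℕ)] (f a.2))

/-! ### The quasi regularity degree and the difference index -/

/-- `ψ(k)`, the transcendence degree of `κ(Δ_k)` over `K`. -/
def psi (σ : K →+* K) (f : Fin r → DiffPoly n K) (p : Ideal (DiffPoly n K)) [p.IsPrime]
    (k : ℕ) : ℕ :=
  Cardinal.toNat (Algebra.trdeg K (kappaDelta σ f p k))

/-- `μ_{k,i}`, the dimension over `κ` of the kernel of the transpose of `J_{k,i}`. -/
def muAt (σ : K →+* K) (f : Fin r → DiffPoly n K) (p : Ideal (DiffPoly n K)) (k i : ℕ) : ℕ :=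
  Module.finrank (kappa p)
    (LinearMap.ker (((pseudoJac σ f k i).map (toKappa p)).transpose.mulVecLin))

/-- `μ_k`: the numbers `μ_{k,i}` with `i ≥ e - 1` do not depend on `i`; we take `i = e - 1`. -/
def mu (σ : K →+* K) (f : Fin r → DiffPoly n K) (p : Ideal (DiffPoly n K)) (k : ℕ) : ℕ :=
  muAt σ f p k (maxOrd f - 1)

/-- `d k + s` is the quasi dimension polynomial of the system. -/
def IsQuasiDimPoly (σ : K →+* K) (f : Fin r → DiffPoly n K) (p : Ideal (DiffPoly n K))
    [p.IsPrime] (d : ℕ) (s : ℤ) : Prop :=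
  ∀ᶠ k : ℕ in Filter.atTop, (psi σ f p k : ℤ) = d * k + s

/-- The quasi regularity degree `ρ`: the least `k₀` such that `ψ(k)` is given by the quasi
dimension polynomial for all `k ≥ k₀`. -/
def rho (σ : K →+* K) (f : Fin r → DiffPoly n K) (p : Ideal (DiffPoly n K)) [p.IsPrime] : ℕ :=
  sInf {k₀ : ℕ | ∃ (d : ℕ) (s : ℤ), IsQuasiDimPoly σ f p d s ∧
    ∀ k ≥ k₀, (psi σ f p k : ℤ) = d * k + s}

/-- The difference index `ω`: the least `k₀` such that, for some constant `a`,
`μ_k = (d + r - n) k + a` for all `k ≥ k₀`, where `d` is the leading coefficient of the quasi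
dimension polynomial. -/
def omega (σ : K →+* K) (f : Fin r → DiffPoly n K) (p : Ideal (DiffPoly n K)) [p.IsPrime] : ℕ :=
  sInf {k₀ : ℕ | ∃ (d : ℕ) (s a : ℤ), IsQuasiDimPoly σ f p d s ∧
    ∀ k ≥ k₀, (mu σ f p k : ℤ) = ((d : ℤ) + r - n) * k + a}

/-- The set of all `h` with `Δ_{i-e+1+h} ∩ B_i = Δ ∩ B_i`. -/
def indexSet (σ : K →+* K) (f : Fin r → DiffPoly n K) (p : Ideal (DiffPoly n K)) [p.IsPrime]
    (hp : IsSigmaPrime (shift σ) p) (i : ℕ) : Set ℕ :=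
  {h | deltaCap σ f p i h = deltaInfCap σ f p hp i}

end DiffSys

end

/-! Minimality of `p` makes the contraction of Δ to K{Y} equal to `p`: that contraction lies in `p`,
contains [F], and is σ-prime because Δ is reflexive and every Δ_k is prime. Fix i ≥ e-1 and put k =
i-e+1+h. The contractions of Δ_k to A_i are primes which increase with h, lie in `p ∩ A_i`, and
reach it after finitely many steps because A_i is noetherian. For nested primes of a polynomial ring
in finitely many variables, equality can be tested on transcendence degrees, so the theorem becomes
a statement about τ(i,h) = trdeg A_i/(Δ_k ∩ A_i) and its final value t(i).

The Jacobian criterion for a subset of the coordinates (`trdeg_adjoin_add_rank`,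
`trdeg_add_rank_jac`) gives, over κ(Δ_k), τ(i,h) + rank J_k = n(i+1) + rank J_{h,i}; its case h = 0
is ψ(k) + rank J_k = n(k+e). Eliminating rank J_k gives τ(i,h) = ψ(k) + (r-n)h - μ_h
(`IsQuasiPrime.trdeg_eq`), once rank J_{h,i} over κ(Δ_k) is known to be the rank over κ; this
follows from constancy of the ranks, as κ is the limit of the κ(Δ_k).

For k ≥ ρ the function ψ is linear of slope d, so τ(i,h) has its final value exactly when μ_h lies
on its limiting line. Both claims follow (`index_of_numerical`). That ψ is eventually linear at all
comes from concavity of rank J_k in k (`rank_jac_concave`). -/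

open MvPolynomial

/-! ### Gradients of relations and the Jacobian criterion -/

section Jacobian

/-- Enlarge the family to a transcendence basis s. In characteristic 0, L is separable algebraic
over K(s), so K[s] → L is formally étale and Ω_{L/K} is the base change of Ω_{K[s]/K}, which is free
on the differentials of the variables. -/
theorem AlgebraicIndependent.linearIndependent_D {K L : Type*} [Field K] [CharZero K] [Field L]
    [Algebra K L] {ι : Type*} {x : ι → L} (hx : AlgebraicIndependent K x) :
    LinearIndependent L fun i => KaehlerDifferential.D K L (x i) := by
  obtain ⟨s, hs, hb⟩ := exists_isTranscendenceBasis_superset hx.to_subtype_range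
  suffices h : LinearIndependent L fun i : s => KaehlerDifferential.D K L (i : L) from
    h.comp (fun i => (⟨x i, hs ⟨i, rfl⟩⟩ : s)) fun i j hij => hx.injective (congrArg Subtype.val hij)
  let φ : MvPolynomial s K →ₐ[K] L := aeval Subtype.val
  let : Algebra (MvPolynomial s K) L := φ.toRingHom.toAlgebra
  have : IsScalarTower K (MvPolynomial s K) L :=
    IsScalarTower.of_algebraMap_eq fun a => (φ.commutes a).symm
  have hφ : Function.Injective (algebraMap (MvPolynomial s K) L) := hb.1
  have : FaithfulSMul (MvPolynomial s K) L := (faithfulSMul_iff_algebraMap_injective _ _).2 hφ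
  let : Algebra (FractionRing (MvPolynomial s K)) L := FractionRing.liftAlgebra _ _
  have : CharZero (FractionRing (MvPolynomial s K)) :=
    charZero_of_injective_algebraMap (R := K) (algebraMap K _).injective
  have h1 : Algebra.IsAlgebraic (MvPolynomial s K) L := by
    have h2 := hb.isAlgebraic
    refine ⟨fun y => ?_⟩
    obtain ⟨q, hq, hq'⟩ := h2.isAlgebraic y
    let e := hb.1.aevalEquiv
    refine ⟨q.map (e.symm : _ →+* _), ?_, ?_⟩
    · exact (Polynomial.map_ne_zero_iff e.symm.injective).2 hq
    · rw [Polynomial.aeval_def, Polynomial.eval₂_map]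
      rw [Polynomial.aeval_def] at hq'
      convert hq' using 2
      ext z
      obtain ⟨w, rfl⟩ := e.surjective z
      simp [e]
      rfl
  have : Algebra.IsAlgebraic (FractionRing (MvPolynomial s K)) L :=
    (IsFractionRing.comap_isAlgebraic_iff (A := MvPolynomial s K)).1 h1
  have : Algebra.FormallyEtale (FractionRing (MvPolynomial s K)) L :=
    Algebra.FormallyEtale.of_isSeparable _ _
  have : Algebra.FormallyEtale (MvPolynomial s K) (FractionRing (MvPolynomial s K)) :=
    Algebra.FormallyEtale.of_isLocalization (nonZeroDivisors _)
  have : Algebra.FormallyEtale (MvPolynomial s K) L :=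
    Algebra.FormallyEtale.comp _ (FractionRing (MvPolynomial s K)) _
  have h := (((KaehlerDifferential.mvPolynomialBasis K s).baseChange L).map
    (KaehlerDifferential.tensorKaehlerEquivOfFormallyEtale K (MvPolynomial s K) L)).linearIndependent
  convert h using 2 with i
  simp [KaehlerDifferential.mvPolynomialBasis_apply]
  congr 1
  exact (aeval_X (R := K) _ i).symm

theorem MvPolynomial.D_aeval {K L ι : Type*} [Field K] [Field L] [Algebra K L] [Fintype ι]
    (x : ι → L) (q : MvPolynomial ι K) :
    KaehlerDifferential.D K L (aeval x q) =
      ∑ v, aeval x (pderiv v q) • KaehlerDifferential.D K L (x v) := by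
  classical
  induction q using MvPolynomial.induction_on with
  | C a => simp
  | add p q hp hq => simp [hp, hq, add_smul, Finset.sum_add_distrib]
  | mul_X p v hp =>
    have h : ∀ b, aeval x (pderiv b (p * X v)) = x v * aeval x (pderiv b p) +
        if b = v then aeval x p else 0 := by
      intro b
      by_cases hb : b = v
      · subst hb; simp [add_comm]
      · simp [pderiv_X_of_ne (Ne.symm hb), hb]
    rw [Finset.sum_congr rfl fun b _ => by rw [h b]]
    simp only [add_smul, Finset.sum_add_distrib, ite_smul, zero_smul, Finset.sum_ite_eq',
      Finset.mem_univ, if_true, map_mul, aeval_X, Derivation.leibniz, hp, Finset.smul_sum, mul_smul]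
    rw [add_comm]

/-- A relation of least degree has a partial derivative which is not a relation. -/
theorem exists_aeval_pderiv_ne_zero {K L τ : Type*} [Field K] [CharZero K] [Field L] [Algebra K L]
    {x : τ → L} (hx : ¬ AlgebraicIndependent K x) :
    ∃ q : MvPolynomial τ K, aeval x q = 0 ∧ ∃ v, aeval x (pderiv v q) ≠ 0 := by
  classical
  rw [algebraicIndependent_iff] at hx
  push Not at hx
  by_contra! H
  obtain ⟨q, hq0, hq⟩ := hx
  induction h : q.totalDegree using Nat.strong_induction_on generalizing q with
  | _ d ih =>
    subst h
    by_cases hd : ∃ v, pderiv v q ≠ 0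
    · obtain ⟨v, hv⟩ := hd
      refine ih _ ?_ _ (H q hq0 v) hv rfl
      have key : ∀ m ∈ (pderiv v q).support, (m.sum fun _ e => e) < q.totalDegree := by
        intro m hm
        rw [mem_support_iff, coeff_pderiv] at hm
        have h1 := le_totalDegree (mem_support_iff.2 (left_ne_zero_of_mul hm))
        rw [Finsupp.sum_add_index' (fun _ => rfl) (fun _ _ _ => rfl),
          Finsupp.sum_single_index rfl] at h1
        omega
      obtain ⟨m, hm⟩ := support_nonempty.2 hv
      exact (Finset.sup_lt_iff (lt_of_le_of_lt (Nat.zero_le _) (key m hm))).2 key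
    · push Not at hd
      -- In characteristic 0 vanishing of all partial derivatives forces `q` to be constant, and a
      -- constant relation is 0.
      have hc : q = C (coeff 0 q) := by
        ext m
        rw [coeff_C]
        split_ifs with h0
        · rw [h0]
        · obtain ⟨v, hv⟩ := Finsupp.ne_iff.1 (Ne.symm h0)
          have h1 := congrArg (coeff (m - Finsupp.single v 1)) (hd v)
          rw [coeff_pderiv, tsub_add_cancel_of_le, coeff_zero, mul_eq_zero] at h1
          · exact h1.resolve_right (Nat.cast_add_one_ne_zero _)
          · simpa [Nat.one_le_iff_ne_zero] using hv
      rw [hc, aeval_C, map_eq_zero] at hq0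
      rw [hq0, C_0] at hc
      exact hq hc

/-- The space spanned by the gradients at `x` of the relations between the `x i`. -/
def relGrad (K : Type*) {L ι : Type*} [Field K] [Field L] [Algebra K L] (x : ι → L) :
    Submodule L (ι → L) :=
  Submodule.span L {w | ∃ q : MvPolynomial ι K, aeval x q = 0 ∧ w = fun v => aeval x (pderiv v q)}

section relGrad

variable {K L ι : Type*} [Field K] [CharZero K] [Field L] [Algebra K L]

/-- Differentiating relations shows ∑ w_v dx_v = 0 for every w in `relGrad`; the differentials of
independent coordinates are linearly independent. -/
theorem eq_zero_of_mem_relGrad [Fintype ι] {x : ι → L} {T : Set ι}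
    (hT : AlgebraicIndependent K fun t : T => x t) {w : ι → L} (hw : w ∈ relGrad K x)
    (h0 : ∀ v ∉ T, w v = 0) : w = 0 := by
  classical
  have h1 : ∑ v, w v • KaehlerDifferential.D K L (x v) = 0 := by
    clear h0
    induction hw using Submodule.span_induction with
    | mem w hw =>
      obtain ⟨q, hq, rfl⟩ := hw
      rw [← MvPolynomial.D_aeval, hq, map_zero]
    | zero => simp
    | add u v _ _ hu hv => simp [add_smul, Finset.sum_add_distrib, hu, hv]
    | smul a u _ hu => simp [mul_smul, ← Finset.smul_sum, hu]
  have h2 : ∑ v : T, w v • KaehlerDifferential.D K L (x v) = 0 := by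
    rw [← h1, ← Finset.sum_subset (Finset.subset_univ T.toFinset) fun v _ hv => by
      rw [h0 v (by simpa using hv), zero_smul]]
    exact (Finset.sum_subtype _ (fun v => Set.mem_toFinset) fun v =>
      w v • KaehlerDifferential.D K L (x v)).symm
  have h3 := Fintype.linearIndependent_iff.1 hT.linearIndependent_D (fun t : T => w t) h2
  funext v
  by_cases hv : v ∈ T
  · exact h3 ⟨v, hv⟩
  · exact h0 v hv

theorem exists_mem_relGrad {x : ι → L} {T : Set ι}
    (hT : ¬ AlgebraicIndependent K fun t : T => x t) :
    ∃ w ∈ relGrad K x, w ≠ 0 ∧ ∀ v ∉ T, w v = 0 := by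
  classical
  obtain ⟨q, hq, v, hv⟩ := exists_aeval_pderiv_ne_zero hT
  refine ⟨_, Submodule.subset_span ⟨rename Subtype.val q, ?_, rfl⟩, ?_, ?_⟩
  · rwa [aeval_rename]
  · refine Function.ne_iff.2 ⟨v, ?_⟩
    rwa [pderiv_rename Subtype.val_injective, aeval_rename]
  · intro v hv
    have : v ∉ (rename (Subtype.val : T → ι) q).vars := fun h => by
      obtain ⟨t, _, rfl⟩ := Finset.mem_image.1 (vars_rename _ _ h)
      exact hv t.2
    simp [pderiv_eq_zero_of_notMem_vars this]

theorem exists_algebraicIndependent_ncard_eq_trdeg {K L ι : Type*} [Field K] [Field L] [Algebra K L]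
    (x : ι → L) (T : Set ι) :
    ∃ T₁ ⊆ T, AlgebraicIndependent K (fun t : T₁ => x t) ∧
      (∀ t ∈ T, t ∉ T₁ → ¬ AlgebraicIndependent K fun s : ↥(insert t T₁) => x s) ∧
      (Algebra.trdeg K (Algebra.adjoin K (x '' T))).toNat = T₁.ncard := by
  classical
  let S := Algebra.adjoin K (x '' T)
  let y : T → S := fun t => ⟨x t, Algebra.subset_adjoin ⟨t, t.2, rfl⟩⟩
  have hy : Algebra.adjoin K (Set.range y) = ⊤ := by
    rw [← Algebra.adjoin_adjoin_coe_preimage (R := K) (s := x '' T)]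
    congr 1
    ext z
    simp [y, Subtype.ext_iff]
  have : Algebra.IsAlgebraic (Algebra.adjoin K (Set.range y)) S := by
    rw [hy]
    exact ⟨fun z => isAlgebraic_algebraMap (⟨z, trivial⟩ : (⊤ : Subalgebra K S))⟩
  obtain ⟨u, hu, hub⟩ := exists_isTranscendenceBasis_subset (R := K) (Set.range y)
  -- As `y` need not be injective, one index is selected for each element of the transcendence
  -- basis.
  obtain ⟨T', -, hT'⟩ := Set.SurjOn.exists_bijOn_subset (s := Set.univ) (t := u) (f := y) (by
    intro z hz; obtain ⟨t, rfl⟩ := hu hz; exact ⟨t, trivial, rfl⟩)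
  have hb : IsTranscendenceBasis K fun t : T' => y t := by
    rw [← hT'.image_eq] at hub
    exact (isTranscendenceBasis_image hT'.injOn).2 hub
  refine ⟨Subtype.val '' T', ?_, ?_, fun t ht ht1 h => ?_, ?_⟩
  · rintro _ ⟨s, -, rfl⟩
    exact s.2
  · have h := hb.1.map' (f := S.val) Subtype.val_injective
    exact (algebraicIndependent_equiv (Equiv.Set.image Subtype.val T' Subtype.val_injective)).1 h
  · let g : ↥(insert (⟨t, ht⟩ : T) T') → ↥(insert t (Subtype.val '' T')) := fun s =>
      ⟨s.1, s.2.elim (fun h => Or.inl (congrArg Subtype.val h)) fun h => Or.inr ⟨s.1, h, rfl⟩⟩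
    have hg : Function.Injective g := fun a b hab =>
      Subtype.ext (Subtype.ext (by have h := congrArg Subtype.val hab; exact h))
    have h2 : AlgebraicIndependent K fun s : ↥(insert (⟨t, ht⟩ : T) T') => y s :=
      AlgebraicIndependent.of_comp S.val (h.comp g hg)
    have h3 := hb.2 _ h2.to_subtype_range ?_
    · have h4 : y ⟨t, ht⟩ ∈ Set.range fun s : T' => y s := by
        rw [h3]; exact ⟨⟨_, Set.mem_insert _ _⟩, rfl⟩
      obtain ⟨s, hs⟩ := h4
      have h5 := h2.injective (a₁ := ⟨s, Set.mem_insert_of_mem _ s.2⟩)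
        (a₂ := ⟨⟨t, ht⟩, Set.mem_insert _ _⟩) hs
      refine ht1 ⟨s, s.2, ?_⟩
      exact congrArg (fun z => ((z : T) : ι)) (congrArg Subtype.val h5)
    · rintro _ ⟨s, rfl⟩
      exact ⟨⟨s, Set.mem_insert_of_mem _ s.2⟩, rfl⟩
  · rw [Set.ncard_image_of_injective _ Subtype.val_injective]
    have := congrArg Cardinal.toNat hb.lift_cardinalMk_eq_trdeg
    rw [Cardinal.toNat_lift, Cardinal.toNat_lift] at this
    exact this.symm

/-- With T₁ ⊆ T maximal independent, restriction to T \ T₁ is an isomorphism on the gradients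
supported in T. It is injective because nothing nonzero is supported in T₁, and surjective because
each t outside T₁ yields a gradient supported in T₁ ∪ {t} that does not vanish at t. -/
theorem trdeg_adjoin_add_finrank_relGrad [Fintype ι] (x : ι → L) (T : Set ι) :
    (Algebra.trdeg K (Algebra.adjoin K (x '' T))).toNat +
      Module.finrank L ↥(relGrad K x ⊓
        LinearMap.ker (LinearMap.funLeft L L (Subtype.val : (Tᶜ : Set ι) → ι))) = T.ncard := by
  classical
  obtain ⟨T₁, hT₁, hind, hdep, hcard⟩ := exists_algebraicIndependent_ncard_eq_trdeg (K := K) x T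
  suffices h : Module.finrank L ↥(relGrad K x ⊓
      LinearMap.ker (LinearMap.funLeft L L (Subtype.val : (Tᶜ : Set ι) → ι))) = (T \ T₁).ncard by
    rw [h, hcard, add_comm, Set.ncard_sdiff_add_ncard_of_subset hT₁]
  set U := relGrad K x ⊓ LinearMap.ker (LinearMap.funLeft L L (Subtype.val : (Tᶜ : Set ι) → ι))
  have hU : ∀ w, w ∈ U ↔ w ∈ relGrad K x ∧ ∀ v ∉ T, w v = 0 := by
    intro w
    simp only [U, Submodule.mem_inf, LinearMap.mem_ker, _root_.funext_iff]
    simp [LinearMap.funLeft_apply]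
  let ρ : U →ₗ[L] (↥(T \ T₁) → L) := (LinearMap.funLeft L L Subtype.val).comp U.subtype
  have hinj : Function.Injective ρ := by
    rw [injective_iff_map_eq_zero]
    rintro ⟨w, hw⟩ h
    obtain ⟨hw1, hw2⟩ := (hU w).1 hw
    refine Subtype.ext (eq_zero_of_mem_relGrad hind hw1 fun v hv => ?_)
    by_cases hvT : v ∈ T
    · exact congrFun h ⟨v, hvT, hv⟩
    · exact hw2 v hvT
  have hsurj : Function.Surjective ρ := by
    rw [← LinearMap.range_eq_top, eq_top_iff, ← (Pi.basisFun L ↥(T \ T₁)).span_eq,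
      Submodule.span_le]
    rintro _ ⟨t, rfl⟩
    obtain ⟨w, hw, hw0, hwT⟩ := exists_mem_relGrad (hdep t t.2.1 t.2.2)
    have hwt : w t ≠ 0 := fun h => hw0 (eq_zero_of_mem_relGrad hind hw fun v hv => by
      by_cases hvt : v = t
      · rwa [hvt]
      · exact hwT v (by simp [hvt, hv]))
    have hwU : w ∈ U := (hU w).2 ⟨hw, fun v hv => hwT v fun h => hv (h.elim (fun h => h ▸ t.2.1)
      fun h => hT₁ h)⟩
    refine ⟨(w t)⁻¹ • ⟨w, hwU⟩, ?_⟩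
    ext s
    by_cases hst : s = t
    · subst hst; simp [ρ, LinearMap.funLeft_apply, hwt]
    · have h1 : w s = 0 := hwT s fun h => h.elim (fun h => hst (Subtype.ext h)) fun h => s.2.2 h
      simp [ρ, LinearMap.funLeft_apply, h1, hst]
  rw [(LinearEquiv.ofBijective ρ ⟨hinj, hsurj⟩).finrank_eq, Module.finrank_fintype_fun_eq_card,
    ← Nat.card_eq_fintype_card, Nat.card_coe_set_eq]

/-- Since q(x) = 0, the gradient of s·q at x is s(x) times that of q. Hence generators of the ideal
of relations up to multipliers s with s(x) ≠ 0 suffice, which is what a localization provides. -/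
theorem relGrad_eq_span_range {K L ι : Type*} [Field K] [Field L] [Algebra K L] [Fintype ι] {β : Type*} (x : ι → L) (g : β → MvPolynomial ι K)
    (hg : ∀ b, aeval x (g b) = 0)
    (hgen : ∀ q, aeval x q = 0 → ∃ s, aeval x s ≠ 0 ∧ s * q ∈ Ideal.span (Set.range g)) :
    relGrad K x = Submodule.span L (Set.range fun b v => aeval x (pderiv v (g b))) := by
  refine le_antisymm (Submodule.span_le.2 ?_) (Submodule.span_mono ?_)
  · rintro _ ⟨q, hq, rfl⟩
    obtain ⟨s, hs, hsq⟩ := hgen q hq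
    set W := Submodule.span L (Set.range fun b v => aeval x (pderiv v (g b)))
    have key : ∀ h ∈ Ideal.span (Set.range g), aeval x h = 0 ∧
        (fun v => aeval x (pderiv v h)) ∈ W := by
      intro h hh
      induction hh using Submodule.span_induction with
      | mem h hh =>
        obtain ⟨b, rfl⟩ := hh
        exact ⟨hg b, Submodule.subset_span ⟨b, rfl⟩⟩
      | zero => simp only [map_zero]; exact ⟨trivial, W.zero_mem⟩
      | add h h' _ _ ih ih' =>
        simp only [map_add]
        exact ⟨by rw [ih.1, ih'.1, add_zero], W.add_mem ih.2 ih'.2⟩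
      | smul a h _ ih =>
        refine ⟨by simp [ih.1], ?_⟩
        convert W.smul_mem (aeval x a) ih.2 using 1
        ext v
        simp [ih.1]
    have h1 := W.smul_mem (aeval x s)⁻¹ (key _ hsq).2
    have h2 : (fun v => aeval x (pderiv v q)) =
        (aeval x s)⁻¹ • fun v => aeval x (pderiv v (s * q)) := by
      ext v
      simp [hq, hs]
    rwa [h2]
  · rintro _ ⟨b, rfl⟩
    exact ⟨g b, hg b, rfl⟩

/-- The Jacobian criterion for the transcendence degree of a subset of the coordinates. -/
theorem trdeg_adjoin_add_rank [Fintype ι] {β : Type*} [Finite β] (x : ι → L) (T : Set ι)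
    [Fintype (Tᶜ : Set ι)] (g : β → MvPolynomial ι K) (hg : ∀ b, aeval x (g b) = 0)
    (hgen : ∀ q, aeval x q = 0 → ∃ s, aeval x s ≠ 0 ∧ s * q ∈ Ideal.span (Set.range g)) :
    (Algebra.trdeg K (Algebra.adjoin K (x '' T))).toNat +
      (Matrix.of fun b v => aeval x (pderiv v (g b))).rank =
    T.ncard + (Matrix.of fun b (v : (Tᶜ : Set ι)) => aeval x (pderiv (v : ι) (g b))).rank := by
  rw [← trdeg_adjoin_add_finrank_relGrad (K := K) x T, Matrix.rank_eq_finrank_span_row,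
    Matrix.rank_eq_finrank_span_row, add_assoc]
  congr 1
  -- Rank-nullity for the restriction to the coordinates outside T: the image is the row space of
  -- the smaller matrix, and the kernel is the space of gradients supported in T.
  set ρ := LinearMap.funLeft L L (Subtype.val : (Tᶜ : Set ι) → ι)
  have h1 : Submodule.span L (Set.range (Matrix.of fun b v => aeval x (pderiv v (g b))).row) =
      relGrad K x := (relGrad_eq_span_range x g hg hgen).symm
  have h2 : Submodule.span L (Set.range
      (Matrix.of fun b (v : (Tᶜ : Set ι)) => aeval x (pderiv (v : ι) (g b))).row) =
      (relGrad K x).map ρ := by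
    rw [← h1, Submodule.map_span, ← Set.range_comp]
    rfl
  rw [h1, h2, ← LinearMap.finrank_range_add_finrank_ker (ρ.domRestrict (relGrad K x)),
    LinearMap.range_domRestrict, add_comm]
  congr 1
  rw [LinearMap.ker_domRestrict, ← Submodule.map_comap_subtype]
  exact (Submodule.equivSubtypeMap _ _).finrank_eq

end relGrad

/-- A transcendence basis of the target lifts to an independent family, which is a transcendence
basis of the source by the inequality (finite type makes both degrees finite). A nonzero element of
the kernel would divide a nonzero polynomial in the lifts, and the image of that polynomial would be
a relation between the original basis elements. -/
theorem AlgHom.injective_of_trdeg_le {K A A' : Type*} [Field K] [CommRing A] [CommRing A']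
    [IsDomain A] [IsDomain A'] [Algebra K A] [Algebra K A'] [Algebra.FiniteType K A]
    (π : A →ₐ[K] A') (hπ : Function.Surjective π)
    (h : (Algebra.trdeg K A).toNat ≤ (Algebra.trdeg K A').toNat) : Function.Injective π := by
  have : Algebra.FiniteType K A' := Algebra.FiniteType.of_surjective π hπ
  obtain ⟨u, hu⟩ := exists_isTranscendenceBasis K A'
  have hcard := hu.cardinalMk_eq_trdeg
  have hfin := trdeg_lt_aleph0_of_finiteType (R := K) (S := A)
  have hfin' := trdeg_lt_aleph0_of_finiteType (R := K) (S := A')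
  choose x hx using fun a : u => hπ a
  have hxu : π ∘ x = Subtype.val := _root_.funext hx
  have hb : IsTranscendenceBasis K x := by
    refine AlgebraicIndependent.isTranscendenceBasis_of_lift_trdeg_le
      (AlgebraicIndependent.of_comp π (by rw [hxu]; exact hu.1)) hfin ?_
    rw [hcard, ← Cardinal.cast_toNat_of_lt_aleph0 hfin, ← Cardinal.cast_toNat_of_lt_aleph0 hfin']
    simpa using h
  have := hb.isAlgebraic
  rw [injective_iff_map_eq_zero]
  intro a ha
  by_contra ha0
  obtain ⟨q, hq0, hq⟩ := (this.isAlgebraic a).exists_nonzero_dvd (mem_nonZeroDivisors_of_ne_zero ha0)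
  obtain ⟨c, hc⟩ := hq
  obtain ⟨w, rfl⟩ := hb.1.aevalEquiv.surjective q
  have h1 : π (aeval x w) = 0 := by
    have : algebraMap _ A (hb.1.aevalEquiv w) = aeval x w := by simp
    rw [← this, hc, map_mul, ha, zero_mul]
  rw [← AlgHom.comp_apply, comp_aeval, ← Function.comp_def, hxu] at h1
  rw [hu.1.eq_zero_of_aeval_eq_zero w h1, map_zero] at hq0
  exact hq0 rfl

theorem MvPolynomial.ideal_eq_of_trdeg_le {K ι : Type*} [Field K] [Finite ι]
    {P P' : Ideal (MvPolynomial ι K)} [P.IsPrime] [P'.IsPrime] (hP : P ≤ P')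
    (h : (Algebra.trdeg K (MvPolynomial ι K ⧸ P)).toNat ≤
      (Algebra.trdeg K (MvPolynomial ι K ⧸ P')).toNat) : P = P' := by
  refine le_antisymm hP fun a ha => ?_
  have := AlgHom.injective_of_trdeg_le (Ideal.Quotient.factorₐ K hP)
    (Ideal.Quotient.factor_surjective hP) h
  rw [← Ideal.Quotient.eq_zero_iff_mem] at ha ⊢
  exact this (by rw [map_zero]; exact ha)

end Jacobian

/-! ### Ranks of matrices under change of field -/

section Rank

/-- `M = C * D` certifies the upper bound for the rank and `X * M * Y = 1` the lower bound. Such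
identities can be transported along ring homomorphisms. -/
theorem Matrix.exists_rank_factorization {m n κ : Type*} [Field κ] [Fintype m] [Fintype n]
    [DecidableEq m] [DecidableEq n] (M : Matrix m n κ) :
    ∃ (C : Matrix m (Fin M.rank) κ) (D : Matrix (Fin M.rank) n κ) (X : Matrix (Fin M.rank) m κ)
      (Y : Matrix n (Fin M.rank) κ), M = C * D ∧ X * M * Y = 1 := by
  let F := M.toLin'
  let E : LinearMap.range F ≃ₗ[κ] (Fin M.rank → κ) :=
    LinearEquiv.ofFinrankEq _ _ (by rw [Module.finrank_fin_fun]; rfl)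
  let D := E.toLinearMap ∘ₗ F.rangeRestrict
  let C := (LinearMap.range F).subtype ∘ₗ E.symm.toLinearMap
  have hF : C ∘ₗ D = F := by ext; simp [C, D]
  obtain ⟨X, hX⟩ := C.exists_leftInverse_of_injective (LinearMap.ker_eq_bot.2
    (Subtype.val_injective.comp E.symm.injective))
  obtain ⟨Y, hY⟩ := D.exists_rightInverse_of_surjective (LinearMap.range_eq_top.2
    (E.surjective.comp F.surjective_rangeRestrict))
  refine ⟨C.toMatrix', D.toMatrix', X.toMatrix', Y.toMatrix', ?_, ?_⟩
  · rw [← LinearMap.toMatrix'_comp, hF, LinearMap.toMatrix'_toLin']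
  · have h : M = (C ∘ₗ D).toMatrix' := by rw [hF, LinearMap.toMatrix'_toLin']
    refine (congrArg (fun N => X.toMatrix' * N * Y.toMatrix') h).trans ?_
    rw [LinearMap.toMatrix'_comp, ← Matrix.mul_assoc, Matrix.mul_assoc,
      ← LinearMap.toMatrix'_comp, ← LinearMap.toMatrix'_comp, hX, hY]
    simp

theorem Matrix.rank_mul_le_card {m n l κ : Type*} [Field κ] [Fintype m] [Fintype n] [Fintype l]
    (C : Matrix m l κ) (D : Matrix l n κ) : (C * D).rank ≤ Fintype.card l :=
  (Matrix.rank_mul_le_left C D).trans (Matrix.rank_le_card_width C)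

theorem Matrix.card_le_rank_of_mul_eq_one {m n l κ : Type*} [Field κ] [Fintype m] [Fintype n]
    [Fintype l] [DecidableEq l] {M : Matrix m n κ} {X : Matrix l m κ} {Y : Matrix n l κ}
    (h : X * M * Y = 1) : Fintype.card l ≤ M.rank := by
  rw [← Matrix.rank_one (R := κ) (n := l), ← h]
  exact (Matrix.rank_mul_le_left _ _).trans (Matrix.rank_mul_le_right _ _)

theorem Matrix.rank_map_ringHom {m n κ κ' : Type*} [Field κ] [Field κ'] [Fintype m] [Fintype n]
    (φ : κ →+* κ') (M : Matrix m n κ) : (M.map φ).rank = M.rank := by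
  classical
  obtain ⟨C, D, X, Y, h1, h2⟩ := M.exists_rank_factorization
  apply le_antisymm
  · conv_lhs => rw [h1, Matrix.map_mul]
    simpa using Matrix.rank_mul_le_card (C.map φ) (D.map φ)
  · have h : X.map φ * M.map φ * Y.map φ = 1 := by
      rw [← Matrix.map_mul, ← Matrix.map_mul, h2, Matrix.map_one _ φ.map_zero φ.map_one]
    simpa using Matrix.card_le_rank_of_mul_eq_one h

theorem Matrix.exists_smul_eq_map {S κ m n : Type*} [CommRing S] [Field κ] [Finite m] [Finite n]
    (φ : S →+* κ) (hφ : ∀ a : κ, ∃ u b : S, φ u ≠ 0 ∧ φ u * a = φ b) (A : Matrix m n κ) :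
    ∃ (u : S) (A' : Matrix m n S), φ u ≠ 0 ∧ φ u • A = A'.map φ := by
  classical
  have := Fintype.ofFinite m
  have := Fintype.ofFinite n
  choose u b hu hb using hφ
  refine ⟨∏ i : m × n, u (A i.1 i.2), Matrix.of fun i j =>
    (∏ k ∈ Finset.univ.erase (i, j), u (A k.1 k.2)) * b (A i j), ?_, ?_⟩
  · rw [map_prod]
    exact Finset.prod_ne_zero_iff.2 fun i _ => hu _
  · ext i j
    rw [Matrix.smul_apply, Matrix.map_apply, Matrix.of_apply, map_mul, ← hb, smul_eq_mul,
      ← Finset.prod_erase_mul _ _ (Finset.mem_univ (i, j)), map_mul, mul_assoc]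

theorem Matrix.eventually_map_eq_map {S κ : Type*} [CommRing S] [CommRing κ] {κ' : ℕ → Type*}
    [∀ s, CommRing (κ' s)] (φ : S →+* κ) (φ' : ∀ s, S →+* κ' s)
    (h : ∀ g, ∀ᶠ s in Filter.atTop, (φ' s g = 0 ↔ φ g = 0)) {m n : Type*} [Finite m] [Finite n]
    {N N' : Matrix m n S} (hN : N.map φ = N'.map φ) :
    ∀ᶠ s in Filter.atTop, N.map (φ' s) = N'.map (φ' s) := by
  have : ∀ᶠ s in Filter.atTop, ∀ i j, φ' s (N i j) = φ' s (N' i j) := by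
    rw [Filter.eventually_all]
    intro i
    rw [Filter.eventually_all]
    intro j
    filter_upwards [h (N i j - N' i j)] with s hs
    rw [← sub_eq_zero, ← map_sub, hs, map_sub, sub_eq_zero]
    exact congrFun (congrFun hN i) j
  filter_upwards [this] with s hs
  ext i j
  exact hs i j

/-- The rank of a matrix at the generic point of an increasing union of kernels is attained
eventually. -/
theorem Matrix.eventually_rank_map_eq {S κ : Type*} [CommRing S] [Field κ] {κ' : ℕ → Type*}
    [∀ s, Field (κ' s)] (φ : S →+* κ) (φ' : ∀ s, S →+* κ' s)
    (hφ : ∀ a : κ, ∃ u b : S, φ u ≠ 0 ∧ φ u * a = φ b)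
    (h : ∀ g, ∀ᶠ s in Filter.atTop, (φ' s g = 0 ↔ φ g = 0)) {m n : Type*} [Fintype m] [Fintype n]
    (M : Matrix m n S) : ∀ᶠ s in Filter.atTop, (M.map (φ' s)).rank = (M.map φ).rank := by
  classical
  obtain ⟨C, D, X, Y, h1, h2⟩ := (M.map φ).exists_rank_factorization
  obtain ⟨c, C', hc, hC⟩ := Matrix.exists_smul_eq_map φ hφ C
  obtain ⟨d, D', hd, hD⟩ := Matrix.exists_smul_eq_map φ hφ D
  obtain ⟨x, X', hx, hX⟩ := Matrix.exists_smul_eq_map φ hφ X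
  obtain ⟨y, Y', hy, hY⟩ := Matrix.exists_smul_eq_map φ hφ Y
  -- After clearing denominators both certificates are identities between matrices over `S` that
  -- hold under `φ`. They involve finitely many entries, so they hold under `φ' s` for large `s`,
  -- where the denominators also remain nonzero.
  have e1 : ((c * d) • M).map φ = (C' * D').map φ := by
    rw [Matrix.map_mul, ← hC, ← hD, Matrix.smul_mul, Matrix.mul_smul, ← h1, smul_smul]
    ext i j; simp
  have e2 : (X' * M * Y').map φ = ((x * y) • (1 : Matrix (Fin (M.map φ).rank) _ S)).map φ := by
    rw [Matrix.map_mul, Matrix.map_mul, ← hX, ← hY, Matrix.smul_mul, Matrix.smul_mul,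
      Matrix.mul_smul, h2, smul_smul]
    ext i j; simp [Matrix.one_apply, apply_ite φ]
  filter_upwards [h (c * d), h (x * y), Matrix.eventually_map_eq_map φ φ' h e1,
    Matrix.eventually_map_eq_map φ φ' h e2] with s h3 h4 h5 h6
  have h3' : φ' s (c * d) ≠ 0 := by rw [Ne, h3, map_mul]; exact mul_ne_zero hc hd
  have h4' : φ' s (x * y) ≠ 0 := by rw [Ne, h4, map_mul]; exact mul_ne_zero hx hy
  apply le_antisymm
  · have e : M.map (φ' s) = ((φ' s (c * d))⁻¹ • C'.map (φ' s)) * D'.map (φ' s) := by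
      rw [Matrix.smul_mul, ← Matrix.map_mul, ← h5]
      ext i j; simp only [Matrix.smul_apply, Matrix.map_apply, smul_eq_mul, map_mul (φ' s) (c * d)]
      rw [inv_mul_cancel_left₀ h3']
    rw [e]
    simpa using Matrix.rank_mul_le_card ((φ' s (c * d))⁻¹ • C'.map (φ' s)) (D'.map (φ' s))
  · have e : ((φ' s (x * y))⁻¹ • X'.map (φ' s)) * M.map (φ' s) * Y'.map (φ' s) = 1 := by
      rw [Matrix.smul_mul, Matrix.smul_mul, ← Matrix.map_mul, ← Matrix.map_mul, h6]
      ext i j; simp only [Matrix.smul_apply, Matrix.map_apply, smul_eq_mul, map_mul (φ' s) (x * y)]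
      rw [inv_mul_cancel_left₀ h4']
      simp [Matrix.one_apply, apply_ite (φ' s)]
    simpa using Matrix.card_le_rank_of_mul_eq_one e

/-- Restriction to the coordinates in the range of `c` is injective on the span. This places the row
spaces of Jacobian matrices with different column sets in one ambient space. -/
theorem finrank_span_range_eq_rank {κ β γ V : Type*} [Field κ] [Finite β] [Fintype γ]
    (w : β → V → κ) (c : γ → V) (hw : ∀ b, ∀ v ∉ Set.range c, w b v = 0) :
    Module.finrank κ (Submodule.span κ (Set.range w)) =
      (Matrix.of fun b g => w b (c g)).rank := by
  rw [Matrix.rank_eq_finrank_span_row]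
  set W := Submodule.span κ (Set.range w)
  have hW : ∀ u ∈ W, ∀ v ∉ Set.range c, u v = 0 := by
    intro u hu v hv
    induction hu using Submodule.span_induction with
    | mem u hu => obtain ⟨b, rfl⟩ := hu; exact hw b v hv
    | zero => rfl
    | add u u' _ _ h h' => simp [h, h']
    | smul a u _ h => simp [h]
  have h2 : Submodule.span κ (Set.range (Matrix.of fun b g => w b (c g)).row) =
      W.map (LinearMap.funLeft κ κ c) := by
    rw [Submodule.map_span, ← Set.range_comp]
    rfl
  rw [h2, ← LinearMap.range_domRestrict, LinearMap.finrank_range_of_inj]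
  rw [injective_iff_map_eq_zero]
  rintro ⟨u, hu⟩ h0
  ext v
  by_cases hv : v ∈ Set.range c
  · obtain ⟨g, rfl⟩ := hv
    exact congrFun h0 g
  · exact hW u hu v hv

theorem Matrix.rank_of_zero_rows {κ β β' γ : Type*} [Field κ] [Finite β] [Finite β'] [Fintype γ]
    (M : Matrix β γ κ) (c : β' → β) (h : ∀ b ∉ Set.range c, M b = 0) :
    (M.submatrix c id).rank = M.rank := by
  rw [Matrix.rank_eq_finrank_span_row, Matrix.rank_eq_finrank_span_row]
  have : Submodule.span κ (Set.range (M.submatrix c id).row) =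
      Submodule.span κ (Set.range M.row) := by
    refine le_antisymm (Submodule.span_mono ?_) (Submodule.span_le.2 ?_)
    · rintro _ ⟨b, rfl⟩
      exact ⟨c b, rfl⟩
    · rintro _ ⟨b, rfl⟩
      by_cases hb : b ∈ Set.range c
      · obtain ⟨b, rfl⟩ := hb
        exact Submodule.subset_span ⟨b, rfl⟩
      · have : M.row b = 0 := h b hb
        rw [this]
        exact Submodule.zero_mem _
  rw [this]

theorem exists_forall_ge_eq_of_antitone {δ : ℕ → ℕ} (h : Antitone δ) :
    ∃ N, ∀ k ≥ N, δ k = δ N := by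
  obtain ⟨_, ⟨N, rfl⟩, hN⟩ :=
    WellFounded.has_min (wellFounded_lt (α := ℕ)) (Set.range δ) ⟨_, 0, rfl⟩
  exact ⟨N, fun k hk => le_antisymm (h hk) (not_lt.1 (hN _ ⟨k, rfl⟩))⟩

end Rank

noncomputable section

namespace DiffSys

open MvPolynomial Filter

/-! ### Orders of difference polynomials; derivatives and the shift -/

section Order

variable {K : Type*} [Field K] {n : ℕ}

theorem toA_inclA (m : ℕ) (a : A n K m) : toA m (inclA m a) = a :=
  killCompl_rename_app Subtype.val_injective a

theorem inclA_transA {i m : ℕ} (h : i ≤ m) (a : A n K i) : inclA m (transA h a) = inclA i a :=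
  RingHom.congr_fun (inclA_comp_transA h) a

theorem toA_inclA_of_le {i m : ℕ} (h : i ≤ m) (a : A n K i) :
    toA m (inclA i a) = transA h a := by
  rw [← inclA_transA h, toA_inclA]

theorem inclA_toA_of_mem {m : ℕ} {g : DiffPoly n K} (hg : g ∈ (inclA (n := n) (K := K) m).range) :
    inclA m (toA m g) = g := by
  obtain ⟨a, rfl⟩ := hg
  rw [toA_inclA]

theorem range_inclA_mono {i m : ℕ} (h : i ≤ m) :
    (inclA (n := n) (K := K) i).range ≤ (inclA m).range := by
  rintro _ ⟨a, rfl⟩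
  exact ⟨transA h a, inclA_transA h a⟩

theorem eventually_mem_range_inclA (g : DiffPoly n K) :
    ∀ᶠ m in atTop, g ∈ (inclA (n := n) (K := K) m).range := by
  filter_upwards [eventually_ge_atTop (g.vars.sup Prod.snd)] with m hm
  exact ⟨_, inclA_toA m g fun v hv => (Finset.le_sup (f := Prod.snd) hv).trans hm⟩

@[simp] theorem inclA_X (m : ℕ) (v : {v : Fin n × ℕ // v.2 ≤ m}) :
    inclA (K := K) m (X v) = X v.1 := rename_X _ _

@[simp] theorem inclA_C (m : ℕ) (c : K) : inclA (n := n) m (C c) = C c := rename_C _ _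

theorem pderiv_inclA (m : ℕ) (v : {v : Fin n × ℕ // v.2 ≤ m}) (a : A n K m) :
    pderiv v.1 (inclA m a) = inclA m (pderiv v a) :=
  pderiv_rename Subtype.val_injective v a

theorem pderiv_eq_zero_of_mem_range {m : ℕ} {g : DiffPoly n K}
    (hg : g ∈ (inclA (n := n) (K := K) m).range) {v : Fin n × ℕ} (hv : m < v.2) :
    pderiv v g = 0 := by
  classical
  obtain ⟨a, rfl⟩ := hg
  refine pderiv_eq_zero_of_notMem_vars fun h => ?_
  obtain ⟨u, _, rfl⟩ := Finset.mem_image.1 (vars_rename _ _ h)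
  exact absurd u.2 (not_le.2 hv)

variable (σ : K →+* K)

@[simp] theorem shift_C (c : K) : shift (n := n) σ (C c) = C (σ c) := by simp [shift]

@[simp] theorem shift_X (v : Fin n × ℕ) : shift σ (X v) = X (v.1, v.2 + 1) := by simp [shift]

theorem shift_mem_range {m : ℕ} {g : DiffPoly n K} (hg : g ∈ (inclA (n := n) (K := K) m).range) :
    shift σ g ∈ (inclA (n := n) (K := K) (m + 1)).range := by
  obtain ⟨a, rfl⟩ := hg
  induction a using MvPolynomial.induction_on with
  | C c => exact ⟨C (σ c), by simp⟩
  | add a b ha hb => rw [map_add, map_add]; exact add_mem ha hb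
  | mul_X a v ha =>
    rw [map_mul, map_mul]
    exact mul_mem ha ⟨X ⟨(v.1.1, v.1.2 + 1), Nat.succ_le_succ v.2⟩, by simp⟩

/-- Makes J_{k,i+1} the entrywise transform of J_{k,i}. -/
theorem pderiv_shift_succ (j : Fin n) (i : ℕ) (g : DiffPoly n K) :
    pderiv (j, i + 1) (shift σ g) = shift σ (pderiv (j, i) g) := by
  classical
  induction g using MvPolynomial.induction_on with
  | C c => simp
  | add a b ha hb => simp [ha, hb]
  | mul_X a v ha =>
    simp only [map_mul, shift_X, pderiv_mul, ha, map_add, pderiv_X]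
    congr 2
    by_cases h : v = (j, i)
    · subst h; simp
    · have : ((v.1, v.2 + 1) : Fin n × ℕ) ≠ (j, i + 1) := fun h' => h (by
        simp only [Prod.mk.injEq, add_left_inj] at h'; exact Prod.ext h'.1 h'.2)
      rw [Pi.single_eq_of_ne this, Pi.single_eq_of_ne h, map_zero]

theorem pderiv_shift_zero (j : Fin n) (g : DiffPoly n K) : pderiv (j, 0) (shift σ g) = 0 := by
  classical
  induction g using MvPolynomial.induction_on with
  | C c => simp
  | add a b ha hb => simp [ha, hb]
  | mul_X a v ha =>
    simp only [map_mul, shift_X, pderiv_mul, ha, pderiv_X]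
    rw [Pi.single_eq_of_ne (by simp)]
    simp

variable {r : ℕ} (f : Fin r → DiffPoly n K)

theorem iterate_shift_mem_range {j m : ℕ} (l : Fin r) (h : j + maxOrd f ≤ m) :
    (shift σ)^[j] (f l) ∈ (inclA (n := n) (K := K) m).range := by
  refine range_inclA_mono h ?_
  clear h
  induction j with
  | zero =>
    refine ⟨_, inclA_toA _ _ fun v hv => ?_⟩
    rw [zero_add]
    exact (Finset.le_sup (f := Prod.snd) hv).trans
      (Finset.le_sup (f := fun l => (f l).vars.sup Prod.snd) (Finset.mem_univ l))
  | succ j ih =>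
    rw [Function.iterate_succ_apply', Nat.add_right_comm]
    exact shift_mem_range σ ih

end Order

/-! ### Kernels of the maps to the fields κ(Δ_k) -/

section Kernel

/-- The canonical map from a ring to the fraction ring of a quotient. -/
def toFrac {R : Type*} [CommRing R] (I : Ideal R) : R →+* FractionRing (R ⧸ I) :=
  (algebraMap (R ⧸ I) (FractionRing (R ⧸ I))).comp (Ideal.Quotient.mk I)

theorem toFrac_eq_zero_iff {R : Type*} [CommRing R] (I : Ideal R) (x : R) :
    toFrac I x = 0 ↔ x ∈ I :=
  (map_eq_zero_iff _ (IsFractionRing.injective (R ⧸ I) (FractionRing (R ⧸ I)))).trans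
    Ideal.Quotient.eq_zero_iff_mem

theorem exists_toFrac_mul_eq {R : Type*} [CommRing R] (I : Ideal R) [I.IsPrime]
    (z : FractionRing (R ⧸ I)) : ∃ u b : R, toFrac I u ≠ 0 ∧ toFrac I u * z = toFrac I b := by
  obtain ⟨⟨b, u⟩, h⟩ := IsLocalization.surj (nonZeroDivisors (R ⧸ I)) z
  obtain ⟨b, rfl⟩ := Ideal.Quotient.mk_surjective b
  obtain ⟨u, hu⟩ := u
  obtain ⟨u, rfl⟩ := Ideal.Quotient.mk_surjective u
  refine ⟨u, b, fun h0 => ?_, by rw [mul_comm]; exact h⟩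
  rw [toFrac_eq_zero_iff, ← Ideal.Quotient.eq_zero_iff_mem] at h0
  exact nonZeroDivisors.ne_zero hu h0

/-- The fraction field of a quotient of a localization is obtained by inverting elements of the
original ring. -/
theorem exists_toFrac_algebraMap_mul_eq {R S : Type*} [CommRing R] [CommRing S] [Algebra R S]
    (M : Submonoid R) [IsLocalization M S] (I : Ideal S) [I.IsPrime] (z : FractionRing (S ⧸ I)) :
    ∃ a b : R, toFrac I (algebraMap R S b) ≠ 0 ∧
      toFrac I (algebraMap R S b) * z = toFrac I (algebraMap R S a) := by
  obtain ⟨u, b, hu, h⟩ := exists_toFrac_mul_eq I z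
  obtain ⟨⟨c, s⟩, hc⟩ := IsLocalization.surj M u
  obtain ⟨⟨d, t⟩, hd⟩ := IsLocalization.surj M b
  have hM : ∀ m ∈ M, toFrac I (algebraMap R S m) ≠ 0 := fun m hm => by
    rw [Ne, toFrac_eq_zero_iff]
    exact fun h => Ideal.IsPrime.ne_top ‹_› (Ideal.eq_top_of_isUnit_mem _ h
      (IsLocalization.map_units S ⟨m, hm⟩))
  dsimp only at hc hd
  refine ⟨d * s, c * t, ?_, ?_⟩
  · rw [map_mul, map_mul, ← hc, map_mul]
    exact mul_ne_zero (mul_ne_zero hu (hM _ s.2)) (hM _ t.2)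
  · simp only [map_mul, ← hc, ← hd, ← h]
    ring

variable {K : Type*} [Field K] {n r : ℕ} (σ : K →+* K) (f : Fin r → DiffPoly n K)
  (p : Ideal (DiffPoly n K)) [p.IsPrime]

theorem deltaIn_eq_map (m k : ℕ) : deltaIn σ f p m k =
    (Ideal.span {a | ∃ l : Fin r, ∃ j < k, a = toA m ((shift σ)^[j] (f l))}).map
      (algebraMap (A n K m) (B p m)) := by
  rw [Ideal.map_span, deltaIn]
  congr 1
  ext x
  constructor
  · rintro ⟨l, j, hj, rfl⟩
    exact ⟨_, ⟨l, j, hj, rfl⟩, rfl⟩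
  · rintro ⟨_, ⟨l, j, hj, rfl⟩, rfl⟩
    exact ⟨l, j, hj, rfl⟩

theorem algebraMap_mem_deltaIn_iff (m k : ℕ) (a : A n K m) :
    algebraMap (A n K m) (B p m) a ∈ deltaIn σ f p m k ↔ ∃ s : A n K m, inclA m s ∉ p ∧
      s * a ∈ Ideal.span {a | ∃ l : Fin r, ∃ j < k, a = toA m ((shift σ)^[j] (f l))} := by
  rw [deltaIn_eq_map, IsLocalization.algebraMap_mem_map_algebraMap_iff
    (p.comap (inclA m)).primeCompl]
  rfl

theorem toKappaDelta_apply (k : ℕ) (g : DiffPoly n K) :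
    toKappaDelta σ f p k g = toFrac (Delta σ f p k)
      (algebraMap (A n K (k + maxOrd f - 1)) (B p (k + maxOrd f - 1)) (toA _ g)) :=
  IsScalarTower.algebraMap_apply (B p (k + maxOrd f - 1)) (B p (k + maxOrd f - 1) ⧸ Delta σ f p k)
    (kappaDelta σ f p k) _

/-- The index `m` is free up to an equation because i + h and k + e - 1, with k = i - e + 1 + h, are
equal only propositionally. -/
theorem toKappaDelta_eq_zero_iff {m k : ℕ} (hm : m = k + maxOrd f - 1) (g : DiffPoly n K) :
    toKappaDelta σ f p k g = 0 ↔
      algebraMap (A n K m) (B p m) (toA m g) ∈ deltaIn σ f p m k := by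
  subst hm
  exact (Eq.congr_left (toKappaDelta_apply σ f p k g)).trans (toFrac_eq_zero_iff _ _)

theorem exists_toKappaDelta_mul_eq (k : ℕ) (hk : (Delta σ f p k).IsPrime)
    (z : kappaDelta σ f p k) : ∃ a b : A n K (k + maxOrd f - 1),
      toKappaDelta σ f p k (inclA _ b) ≠ 0 ∧
        toKappaDelta σ f p k (inclA _ b) * z = toKappaDelta σ f p k (inclA _ a) := by
  obtain ⟨a, b, h⟩ := exists_toFrac_algebraMap_mul_eq
    (p.comap (inclA (k + maxOrd f - 1))).primeCompl (Delta σ f p k) z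
  refine ⟨a, b, ?_⟩
  rwa [toKappaDelta_apply, toKappaDelta_apply, toA_inclA, toA_inclA]

theorem toKappaDelta_iterate {j k : ℕ} (hj : j < k) (l : Fin r) :
    toKappaDelta σ f p k ((shift σ)^[j] (f l)) = 0 :=
  (toKappaDelta_eq_zero_iff σ f p rfl _).2 (Ideal.subset_span ⟨l, j, hj, rfl⟩)

theorem toKappaDelta_ne_zero {k : ℕ} (hk : Delta σ f p k ≠ ⊤) {s : DiffPoly n K} (hs : s ∉ p)
    (h : s ∈ (inclA (n := n) (K := K) (k + maxOrd f - 1)).range) :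
    toKappaDelta σ f p k s ≠ 0 := by
  intro h0
  rw [toKappaDelta_eq_zero_iff σ f p rfl] at h0
  refine hk (Ideal.eq_top_of_isUnit_mem _ h0 ?_)
  refine IsLocalization.map_units _ (⟨_, ?_⟩ : (p.comap (inclA (k + maxOrd f - 1))).primeCompl)
  change inclA _ (toA _ s) ∉ p
  rwa [inclA_toA_of_mem h]

/-- Clears denominators. The multiplier stays in A_{k-1+e} and outside `p`, so it is a unit in all
the later local rings as well. -/
theorem exists_mul_mem_span {k : ℕ} (he : 1 ≤ maxOrd f) {g : DiffPoly n K}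
    (hg : g ∈ (inclA (n := n) (K := K) (k + maxOrd f - 1)).range)
    (h : toKappaDelta σ f p k g = 0) :
    ∃ s ∉ p, s ∈ (inclA (n := n) (K := K) (k + maxOrd f - 1)).range ∧
      s * g ∈ Ideal.span {x | ∃ l : Fin r, ∃ j < k, x = (shift σ)^[j] (f l)} := by
  rw [toKappaDelta_eq_zero_iff σ f p rfl, algebraMap_mem_deltaIn_iff] at h
  obtain ⟨s, hs, hsg⟩ := h
  refine ⟨inclA _ s, hs, ⟨s, rfl⟩, ?_⟩
  have := Ideal.mem_map_of_mem (inclA _) hsg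
  rw [map_mul, inclA_toA_of_mem hg, Ideal.map_span] at this
  refine Ideal.span_mono ?_ this
  rintro _ ⟨_, ⟨l, j, hj, rfl⟩, rfl⟩
  exact ⟨l, j, hj, inclA_toA_of_mem (iterate_shift_mem_range σ f l (by omega))⟩

theorem toKappaDelta_eq_zero_of_mem_span {k k' : ℕ} (h : k ≤ k') {g : DiffPoly n K}
    (hg : g ∈ Ideal.span {x | ∃ l : Fin r, ∃ j < k, x = (shift σ)^[j] (f l)}) :
    toKappaDelta σ f p k' g = 0 := by
  suffices h : Ideal.span {x | ∃ l : Fin r, ∃ j < k, x = (shift σ)^[j] (f l)} ≤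
    RingHom.ker (toKappaDelta σ f p k') from h hg
  rw [Ideal.span_le]
  rintro _ ⟨l, j, hj, rfl⟩
  exact toKappaDelta_iterate σ f p (hj.trans_le h) l

end Kernel

/-! ### Quasi-prime systems: Δ and the limit of the κ(Δ_k) -/

section QuasiPrime

variable {K : Type*} [Field K] {n r : ℕ} {σ : K →+* K} {f : Fin r → DiffPoly n K}
  {p : Ideal (DiffPoly n K)} [p.IsPrime] {hp : IsSigmaPrime (shift σ) p}

theorem IsQuasiPrime.isDomain (hF : IsQuasiPrime σ f p hp) (k : ℕ) :
    IsDomain (B p (k + maxOrd f - 1) ⧸ Delta σ f p k) :=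
  have := hF.prime_delta k
  Ideal.Quotient.isDomain _

theorem IsQuasiPrime.toKappaDelta_mono (hF : IsQuasiPrime σ f p hp) (he : 1 ≤ maxOrd f)
    {k k' : ℕ} (hk : k ≤ k') {g : DiffPoly n K}
    (hg : g ∈ (inclA (n := n) (K := K) (k + maxOrd f - 1)).range)
    (h : toKappaDelta σ f p k g = 0) : toKappaDelta σ f p k' g = 0 := by
  have := hF.isDomain k'
  obtain ⟨s, hs, hs', hsg⟩ := exists_mul_mem_span σ f p he hg h
  have h1 := toKappaDelta_eq_zero_of_mem_span σ f p hk hsg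
  rw [map_mul, mul_eq_zero] at h1
  exact h1.resolve_left (toKappaDelta_ne_zero σ f p (hF.prime_delta k').ne_top hs
    (range_inclA_mono (by omega) hs'))

/-- An element of [F] involves only finitely many transforms of the system, and the multiplier `s`
becomes a unit as soon as its order allows. -/
theorem IsQuasiPrime.eventually_toKappaDelta_eq_zero (hF : IsQuasiPrime σ f p hp)
    {s g : DiffPoly n K} (hs : s ∉ p) (h : s * g ∈ sigmaSpan (shift σ) (Set.range f)) :
    ∀ᶠ k in atTop, toKappaDelta σ f p k g = 0 := by
  have h1 : ∀ᶠ k in atTop, toKappaDelta σ f p k (s * g) = 0 := by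
    rw [sigmaSpan] at h
    generalize s * g = y at h
    induction h using Submodule.span_induction with
    | mem x hx =>
      obtain ⟨_, ⟨l, rfl⟩, j, rfl⟩ := hx
      filter_upwards [eventually_gt_atTop j] with k hk
      exact toKappaDelta_iterate σ f p hk l
    | zero => exact Eventually.of_forall fun k => map_zero _
    | add x y _ _ hx hy =>
      filter_upwards [hx, hy] with k h h'
      exact (RingHom.ker (toKappaDelta σ f p k)).add_mem h h'
    | smul a x _ hx =>
      filter_upwards [hx] with k h
      exact (RingHom.ker (toKappaDelta σ f p k)).mul_mem_left a h
  have h2 : ∀ᶠ k in atTop, s ∈ (inclA (n := n) (K := K) (k + maxOrd f - 1)).range := by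
    obtain ⟨N, hN⟩ := eventually_atTop.1 (eventually_mem_range_inclA s)
    filter_upwards [eventually_ge_atTop (N + 1)] with k hk
    exact hN _ (by omega)
  filter_upwards [h1, h2] with k h h'
  have := hF.isDomain k
  rw [map_mul, mul_eq_zero] at h
  exact h.resolve_left (toKappaDelta_ne_zero σ f p (hF.prime_delta k).ne_top hs h')

theorem exists_mul_mem_sigmaSpan_of_frequently (he : 1 ≤ maxOrd f) {g : DiffPoly n K}
    (h : ∃ᶠ k in atTop, toKappaDelta σ f p k g = 0) :
    ∃ s ∉ p, s * g ∈ sigmaSpan (shift σ) (Set.range f) := by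
  have h2 : ∀ᶠ k in atTop, g ∈ (inclA (n := n) (K := K) (k + maxOrd f - 1)).range := by
    obtain ⟨N, hN⟩ := eventually_atTop.1 (eventually_mem_range_inclA g)
    filter_upwards [eventually_ge_atTop (N + 1)] with k hk
    exact hN _ (by omega)
  obtain ⟨k, hk, hk'⟩ := (h.and_eventually h2).exists
  obtain ⟨s, hs, -, hsg⟩ := exists_mul_mem_span σ f p he hk' hk
  refine ⟨s, hs, Ideal.span_mono ?_ hsg⟩
  rintro _ ⟨l, j, -, rfl⟩
  exact ⟨_, ⟨l, rfl⟩, j, rfl⟩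

theorem DeltaInf_eq_map (hp : IsSigmaPrime (shift σ) p) : DeltaInf σ f p hp =
    (sigmaSpan (shift σ) (Set.range f)).map
      (algebraMap (DiffPoly n K) (Localization.AtPrime p)) := by
  have h : ∀ (j : ℕ) (g : DiffPoly n K), (locSigma (shift σ) p hp)^[j]
      (algebraMap _ (Localization.AtPrime p) g) = algebraMap _ _ ((shift σ)^[j] g) := by
    intro j g
    induction j with
    | zero => rfl
    | succ j ih =>
      rw [Function.iterate_succ_apply', ih, Function.iterate_succ_apply', locSigma,
        Localization.localRingHom_to_map]
  rw [DeltaInf, sigmaSpan, sigmaSpan, Ideal.map_span]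
  congr 1
  ext x
  constructor
  · rintro ⟨_, ⟨l, rfl⟩, j, rfl⟩
    exact ⟨_, ⟨_, ⟨l, rfl⟩, j, rfl⟩, (h j _).symm⟩
  · rintro ⟨_, ⟨_, ⟨l, rfl⟩, j, rfl⟩, rfl⟩
    exact ⟨_, ⟨l, rfl⟩, j, (h j _).symm⟩

theorem algebraMap_mem_DeltaInf_iff (hp : IsSigmaPrime (shift σ) p) (g : DiffPoly n K) :
    algebraMap (DiffPoly n K) (Localization.AtPrime p) g ∈ DeltaInf σ f p hp ↔
      ∃ s ∉ p, s * g ∈ sigmaSpan (shift σ) (Set.range f) := by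
  rw [DeltaInf_eq_map, IsLocalization.algebraMap_mem_map_algebraMap_iff p.primeCompl]
  rfl

/-- For a quasi-prime system, `Δ` is the maximal ideal of `K{Y}_p`. -/
theorem IsQuasiPrime.comap_DeltaInf (hF : IsQuasiPrime σ f p hp) (he : 1 ≤ maxOrd f)
    (hmin : Minimal (fun q : Ideal (DiffPoly n K) => IsSigmaPrime (shift σ) q ∧
      sigmaSpan (shift σ) (Set.range f) ≤ q) p) :
    (DeltaInf σ f p hp).comap (algebraMap (DiffPoly n K) (Localization.AtPrime p)) = p := by
  set q := (DeltaInf σ f p hp).comap (algebraMap (DiffPoly n K) (Localization.AtPrime p))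
  have hq : ∀ g, g ∈ q ↔ ∃ s ∉ p, s * g ∈ sigmaSpan (shift σ) (Set.range f) :=
    algebraMap_mem_DeltaInf_iff hp
  have hqp : q ≤ p := by
    intro g hg
    obtain ⟨s, hs, hsg⟩ := (hq g).1 hg
    exact (Ideal.IsPrime.mem_or_mem ‹_› (hmin.1.2 hsg)).resolve_left hs
  -- By minimality of `p` it suffices that `q`, which lies in `p`, is σ-prime and contains [F].
  refine le_antisymm hqp (hmin.2 ⟨⟨?_, ?_, ?_⟩, ?_⟩ hqp)
  · intro g hg
    obtain ⟨s, hs, hsg⟩ := (hq g).1 hg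
    refine (hq _).2 ⟨shift σ s, fun h => hs (hp.isReflexive _ h), ?_⟩
    rw [← map_mul]
    exact (sigmaSpan_isLeast _ _).1.2 _ hsg
  · intro g hg
    refine hF.reflexive _ ?_
    rw [locSigma, Localization.localRingHom_to_map]
    exact hg
  · refine ⟨fun h => Ideal.IsPrime.ne_top ‹p.IsPrime› (top_le_iff.1 (h ▸ hqp)), ?_⟩
    intro a b hab
    obtain ⟨s, hs, hsab⟩ := (hq _).1 hab
    have h1 := hF.eventually_toKappaDelta_eq_zero hs hsab
    -- Primality of Δ_k puts `a` or `b` in the kernel for each large k, so one of them is in it for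
    -- arbitrarily large k; that is enough for membership in `q`.
    have h2 : ∀ᶠ k in atTop, toKappaDelta σ f p k a = 0 ∨ toKappaDelta σ f p k b = 0 := by
      filter_upwards [h1] with k hk
      have := hF.isDomain k
      rwa [map_mul, mul_eq_zero] at hk
    rcases frequently_or_distrib.1 h2.frequently with h | h
    · exact Or.inl ((hq a).2 (exists_mul_mem_sigmaSpan_of_frequently he h))
    · exact Or.inr ((hq b).2 (exists_mul_mem_sigmaSpan_of_frequently he h))
  · intro g hg
    exact (hq g).2 ⟨1, fun h => Ideal.IsPrime.ne_top ‹p.IsPrime› ((Ideal.eq_top_iff_one p).2 h),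
      by rwa [one_mul]⟩

/-- The precise sense in which κ is the limit of the κ(Δ_k); the threshold for k depends on `g`. -/
theorem IsQuasiPrime.eventually_toKappaDelta_eq_zero_iff (hF : IsQuasiPrime σ f p hp)
    (he : 1 ≤ maxOrd f)
    (hmin : Minimal (fun q : Ideal (DiffPoly n K) => IsSigmaPrime (shift σ) q ∧
      sigmaSpan (shift σ) (Set.range f) ≤ q) p) (g : DiffPoly n K) :
    ∀ᶠ k in atTop, (toKappaDelta σ f p k g = 0 ↔ g ∈ p) := by
  have hq : g ∈ p ↔ ∃ s ∉ p, s * g ∈ sigmaSpan (shift σ) (Set.range f) := by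
    rw [← algebraMap_mem_DeltaInf_iff hp, ← Ideal.mem_comap, hF.comap_DeltaInf he hmin]
  by_cases hg : g ∈ p
  · obtain ⟨s, hs, hsg⟩ := hq.1 hg
    filter_upwards [hF.eventually_toKappaDelta_eq_zero hs hsg] with k hk
    exact iff_of_true hk hg
  · by_contra h
    refine hg (hq.2 (exists_mul_mem_sigmaSpan_of_frequently he ?_))
    exact (not_eventually.1 h).mono fun k hk => not_not.1 fun h0 => hk (iff_of_false h0 hg)

end QuasiPrime

/-! ### The Jacobian criterion for the system -/

section Jacobian

variable {K : Type*} [Field K] {n r : ℕ}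

/-- The variables of order at most `m`, indexed by order and component. -/
def varEquiv (n : ℕ) {N m : ℕ} (h : N = m + 1) :
    Fin N × Fin n ≃ {v : Fin n × ℕ // v.2 ≤ m} where
  toFun b := ⟨(b.2, b.1), by have := b.1.2; dsimp only; omega⟩
  invFun v := (⟨v.1.2, by have := v.2; omega⟩, v.1.1)
  left_inv _ := rfl
  right_inv _ := rfl

/-- The variables of order at most `i + h` and greater than `i`. -/
def varComplEquiv (n i h : ℕ) {m : ℕ} (hm : m = i + h) :
    Fin h × Fin n ≃ ({v : {v : Fin n × ℕ // v.2 ≤ m} | v.1.2 ≤ i}ᶜ : Set _) where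
  toFun b := ⟨⟨(b.2, i + 1 + b.1), by have := b.1.2; dsimp only; omega⟩, by
    simp only [Set.mem_compl_iff, Set.mem_ofPred_eq]; omega⟩
  invFun v := (⟨v.1.1.2 - (i + 1), by
    have := v.1.2; have := v.2; simp only [Set.mem_compl_iff, Set.mem_ofPred_eq] at this
    omega⟩, v.1.1.1)
  left_inv b := by ext <;> simp
  right_inv v := by
    have := v.2
    simp only [Set.mem_compl_iff, Set.mem_ofPred_eq] at this
    refine Subtype.ext (Subtype.ext (Prod.ext rfl ?_))
    dsimp only
    omega

theorem ncard_order_le (n : ℕ) {i m : ℕ} (h : i ≤ m) :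
    ({v : {v : Fin n × ℕ // v.2 ≤ m} | v.1.2 ≤ i}).ncard = n * (i + 1) := by
  rw [← Nat.card_coe_set_eq]
  let e : {v : {v : Fin n × ℕ // v.2 ≤ m} | v.1.2 ≤ i} ≃ Fin (i + 1) × Fin n :=
    { toFun := fun v => (varEquiv n rfl).symm ⟨v.1.1, v.2⟩
      invFun := fun b => ⟨⟨(varEquiv n rfl b).1, (varEquiv n rfl b).2.trans h⟩,
        (varEquiv n rfl b).2⟩
      left_inv := fun _ => rfl
      right_inv := fun _ => rfl }
  rw [Nat.card_congr e, Nat.card_prod, Nat.card_fin, Nat.card_fin, mul_comm]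

variable {L : Type*} [Field L] [Algebra K L]

theorem aeval_eq_comp_inclA (φ : DiffPoly n K →+* L) (hC : ∀ c, φ (C c) = algebraMap K L c) (m : ℕ)
    (a : A n K m) :
    aeval (fun v : {v : Fin n × ℕ // v.2 ≤ m} => φ (X v.1)) a = φ (inclA m a) := by
  induction a using MvPolynomial.induction_on with
  | C c => simp [hC]
  | add a b ha hb => simp [ha, hb]
  | mul_X a v ha => simp [ha]

theorem trdeg_quotient_ker_eq {K L : Type*} {n : ℕ} [Field K] [Field L] [Algebra K L]
    (φ : DiffPoly n K →+* L) (hC : ∀ c, φ (C c) = algebraMap K L c) {i m : ℕ} (h : i ≤ m) :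
    (Algebra.trdeg K (A n K i ⧸ RingHom.ker (φ.comp (inclA i)))).toNat =
      (Algebra.trdeg K (Algebra.adjoin K ((fun v : {v : Fin n × ℕ // v.2 ≤ m} => φ (X v.1)) ''
        {v | v.1.2 ≤ i}))).toNat := by
  let ψ : A n K i →ₐ[K] L := aeval fun v => φ (X v.1)
  have h1 : RingHom.ker (φ.comp (inclA i)) = RingHom.ker ψ := by
    ext a
    rw [RingHom.mem_ker, RingHom.mem_ker, RingHom.comp_apply]
    exact Eq.congr_left (aeval_eq_comp_inclA φ hC i a).symm
  have h2 : Algebra.adjoin K ((fun v : {v : Fin n × ℕ // v.2 ≤ m} => φ (X v.1)) ''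
        {v | v.1.2 ≤ i}) = ψ.range := by
    rw [← Algebra.adjoin_range_eq_range_aeval]
    congr 1
    ext y
    constructor
    · rintro ⟨v, hv, rfl⟩
      exact ⟨⟨v.1, hv⟩, rfl⟩
    · rintro ⟨v, rfl⟩
      exact ⟨⟨v.1, v.2.trans h⟩, v.2, rfl⟩
  rw [h1, h2]
  have := congrArg Cardinal.toNat (Ideal.quotientKerEquivRange ψ).lift_trdeg_eq
  rwa [Cardinal.toNat_lift, Cardinal.toNat_lift] at this

/-- The Jacobian criterion for a difference system. -/
theorem trdeg_add_rank_jac [CharZero K] (σ : K →+* K) (f : Fin r → DiffPoly n K)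
    (φ : DiffPoly n K →+* L) (hC : ∀ c, φ (C c) = algebraMap K L c) {i h k : ℕ}
    (hi : maxOrd f ≤ i + 1) (hk : k = i + 1 - maxOrd f + h)
    (hf : ∀ j < k, ∀ l, φ ((shift σ)^[j] (f l)) = 0)
    (hgen : ∀ g ∈ (inclA (n := n) (K := K) (k + maxOrd f - 1)).range, φ g = 0 →
      ∃ s ∈ (inclA (n := n) (K := K) (k + maxOrd f - 1)).range, φ s ≠ 0 ∧
        s * g ∈ Ideal.span {x | ∃ l : Fin r, ∃ j < k, x = (shift σ)^[j] (f l)}) :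
    (Algebra.trdeg K (A n K i ⧸ RingHom.ker (φ.comp (inclA i)))).toNat +
      ((jac σ f k).map φ).rank = n * (i + 1) + ((pseudoJac σ f h i).map φ).rank := by
  classical
  have hm : k + maxOrd f - 1 = i + h := by omega
  have hN : k + maxOrd f = i + h + 1 := by omega
  rw [hm] at hgen
  set m := i + h with hm'
  let _ : Fintype {v : Fin n × ℕ // v.2 ≤ m} := Fintype.ofEquiv _ (varEquiv n hN)
  -- The criterion is applied to the coordinates of order at most i, so the complementary columns
  -- are those of J_{h,i}.
  let T : Set {v : Fin n × ℕ // v.2 ≤ m} := {v | v.1.2 ≤ i}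
  let _ : Fintype (Tᶜ : Set _) := Fintype.ofEquiv _ (varComplEquiv n i h rfl)
  let x : {v : Fin n × ℕ // v.2 ≤ m} → L := fun v => φ (X v.1)
  let g : Fin k × Fin r → A n K m := fun b => toA m ((shift σ)^[b.1] (f b.2))
  have hx : ∀ a, aeval x a = φ (inclA m a) := aeval_eq_comp_inclA φ hC m
  have hg : ∀ b, inclA m (g b) = (shift σ)^[b.1] (f b.2) := fun b =>
    inclA_toA_of_mem (iterate_shift_mem_range σ f b.2 (by have := b.1.2; omega))
  have hd : ∀ b v, aeval x (pderiv v (g b)) = φ (pderiv v.1 ((shift σ)^[b.1] (f b.2))) :=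
    fun b v => by rw [hx, ← pderiv_inclA, hg]
  have key := trdeg_adjoin_add_rank x T g (fun b => by rw [hx, hg]; exact hf _ b.1.2 _) (by
    intro q hq
    rw [hx] at hq
    obtain ⟨_, ⟨s, rfl⟩, hs, hsg⟩ := hgen _ ⟨q, rfl⟩ hq
    refine ⟨s, by rwa [hx], ?_⟩
    have := Ideal.mem_map_of_mem (toA m) hsg
    rw [map_mul, toA_inclA, toA_inclA, Ideal.map_span] at this
    refine Ideal.span_mono ?_ this
    rintro _ ⟨_, ⟨l, j, hj, rfl⟩, rfl⟩
    exact ⟨(⟨j, hj⟩, l), rfl⟩)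
  rw [ncard_order_le n (Nat.le_add_right i h)] at key
  rw [trdeg_quotient_ker_eq φ hC (Nat.le_add_right i h)]
  have e1 : (jac σ f k).map φ = (Matrix.of fun b v => aeval x (pderiv v (g b))).submatrix
      (Equiv.refl _) (varEquiv n hN) := by
    ext b v
    simp only [Matrix.submatrix_apply, Matrix.of_apply, hd]
    rfl
  have e2 : (pseudoJac σ f h i).map φ =
      ((Matrix.of fun b (v : (Tᶜ : Set _)) => aeval x (pderiv v.1 (g b))).submatrix
        (Equiv.refl _) (varComplEquiv n i h rfl)).submatrix
        (fun b : Fin h × Fin r =>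
          ((⟨i + 1 - maxOrd f + b.1, by have := b.1.2; omega⟩, b.2) : Fin k × Fin r)) id := by
    ext b v
    simp only [Matrix.submatrix_apply, Matrix.of_apply, hd]
    rfl
  rw [e1, Matrix.rank_submatrix, e2, Matrix.rank_of_zero_rows, Matrix.rank_submatrix]
  · exact key
  -- The rows absent from J_{h,i} belong to transforms with j + e ≤ i. These contain no variable of
  -- order above i, so the rows vanish on the remaining columns.
  · rintro ⟨j, l⟩ hj
    ext v
    simp only [Matrix.submatrix_apply, Matrix.of_apply, hd]
    rw [pderiv_eq_zero_of_mem_range (m := i), map_zero]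
    · rfl
    · refine iterate_shift_mem_range σ f l ?_
      by_contra hlt
      change ¬ (j : ℕ) + maxOrd f ≤ i at hlt
      have := j.2
      exact hj ⟨(⟨j - (i + 1 - maxOrd f), by omega⟩, l),
        Prod.ext (Fin.ext (by dsimp only; omega)) rfl⟩
    · have := (varComplEquiv n i h rfl v).2
      exact not_le.1 this

end Jacobian

/-! ### Shift invariance of μ and concavity of the rank of J_k -/

section Shift

variable {K : Type*} [Field K] {n r : ℕ} {σ : K →+* K} (f : Fin r → DiffPoly n K)
  {p : Ideal (DiffPoly n K)} [p.IsPrime]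

theorem toKappa_eq_zero_iff (p : Ideal (DiffPoly n K)) (g : DiffPoly n K) :
    toKappa p g = 0 ↔ g ∈ p :=
  toFrac_eq_zero_iff p g

theorem exists_toKappa_mul_eq (a : kappa p) :
    ∃ u b : DiffPoly n K, toKappa p u ≠ 0 ∧ toKappa p u * a = toKappa p b :=
  exists_toFrac_mul_eq p a

/-- The endomorphism of `κ` induced by `σ`. -/
theorem exists_kappaShift (hp : IsSigmaPrime (shift σ) p) :
    ∃ s : kappa p →+* kappa p, ∀ g, s (toKappa p g) = toKappa p (shift σ g) := by
  let q : DiffPoly n K ⧸ p →+* DiffPoly n K ⧸ p := Ideal.quotientMap p (shift σ) hp.eq_comap.le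
  have hq : Function.Injective q := Ideal.quotientMap_injective' hp.eq_comap.ge
  have hq' : Function.Injective ((algebraMap (DiffPoly n K ⧸ p) (kappa p)).comp q) :=
    (IsFractionRing.injective (DiffPoly n K ⧸ p) (kappa p)).comp hq
  exact ⟨IsFractionRing.lift hq', fun g => IsFractionRing.lift_algebraMap hq' _⟩

/-- The matrix for i + 1 is the image of the matrix for i under the endomorphism of κ induced by σ,
and field homomorphisms preserve rank. -/
theorem rank_pseudoJac_succ (hp : IsSigmaPrime (shift σ) p) (k : ℕ) {i : ℕ}
    (hi : maxOrd f ≤ i + 1) : ((pseudoJac σ f k (i + 1)).map (toKappa p)).rank =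
      ((pseudoJac σ f k i).map (toKappa p)).rank := by
  obtain ⟨s, hs⟩ := exists_kappaShift hp
  rw [← Matrix.rank_map_ringHom s ((pseudoJac σ f k i).map (toKappa p))]
  congr 1
  ext a b
  simp only [Matrix.map_apply, pseudoJac, Matrix.of_apply, hs]
  rw [← pderiv_shift_succ, ← Function.iterate_succ_apply' (shift σ)]
  rw [Nat.add_right_comm (i + 1) 1 b.1,
    show i + 1 + 1 - maxOrd f + a.1 = (i + 1 - maxOrd f + a.1).succ by omega]

theorem rank_pseudoJac_eq (hp : IsSigmaPrime (shift σ) p) (k : ℕ) {i : ℕ}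
    (he : 1 ≤ maxOrd f) (hi : maxOrd f ≤ i + 1) : ((pseudoJac σ f k i).map (toKappa p)).rank =
      ((pseudoJac σ f k (maxOrd f - 1)).map (toKappa p)).rank := by
  obtain ⟨j, rfl⟩ : ∃ j, i = maxOrd f - 1 + j := ⟨i - (maxOrd f - 1), by omega⟩
  clear hi
  induction j with
  | zero => rfl
  | succ j ih => rw [← ih, ← add_assoc, rank_pseudoJac_succ f hp k (by omega)]

theorem mu_add_rank (hp : IsSigmaPrime (shift σ) p) (k : ℕ) {i : ℕ}
    (he : 1 ≤ maxOrd f) (hi : maxOrd f ≤ i + 1) :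
    mu σ f p k + ((pseudoJac σ f k i).map (toKappa p)).rank = k * r := by
  rw [rank_pseudoJac_eq f hp k he hi, ← Matrix.rank_transpose, add_comm, mu, muAt]
  have := LinearMap.finrank_range_add_finrank_ker
    (((pseudoJac σ f k (maxOrd f - 1)).map (toKappa p)).transpose.mulVecLin)
  rw [Module.finrank_fintype_fun_eq_card] at this
  simpa [Matrix.rank] using this

/-- Let W(a,k) be the span of the gradients of F^{(a)}, …, F^{(a+k-1)} over κ. Its dimension is the
same for a = 0 and a = 1. Now W(0,k+1) + W(1,k+1) = W(0,k+2), the intersection contains W(1,k), and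
the dimension formula gives the inequality. -/
theorem rank_jac_concave (hp : IsSigmaPrime (shift σ) p) (k : ℕ) :
    ((jac σ f (k + 2)).map (toKappa p)).rank + ((jac σ f k).map (toKappa p)).rank ≤
      2 * ((jac σ f (k + 1)).map (toKappa p)).rank := by
  classical
  obtain ⟨s, hs⟩ := exists_kappaShift hp
  let w : ℕ → Fin r → Fin n × ℕ → kappa p := fun j l v =>
    toKappa p (pderiv v ((shift σ)^[j] (f l)))
  let W : ℕ → ℕ → Submodule (kappa p) (Fin n × ℕ → kappa p) := fun a k =>
    Submodule.span _ (Set.range fun b : Fin k × Fin r => w (a + b.1) b.2)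
  have h0 : ∀ k, Module.finrank (kappa p) (W 0 k) = ((jac σ f k).map (toKappa p)).rank := by
    intro k
    rw [finrank_span_range_eq_rank _ (fun b : Fin (k + maxOrd f) × Fin n => (b.2, (b.1 : ℕ)))]
    · congr 1
      ext a b
      simp [w, jac]
    · rintro b v hv
      have hv' : k + maxOrd f ≤ v.2 := by
        by_contra hlt
        exact hv ⟨(⟨v.2, not_le.1 hlt⟩, v.1), rfl⟩
      have hb := b.1.2
      simp only [w]
      rw [pderiv_eq_zero_of_mem_range (iterate_shift_mem_range σ f _ le_rfl) (by omega), map_zero]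
  -- The gradients spanning W(1,k) are the σ-images of those spanning W(0,k), moved up by one order;
  -- the derivatives in order 0 vanish.
  have h1 : ∀ k, Module.finrank (kappa p) (W 1 k) = ((jac σ f k).map (toKappa p)).rank := by
    intro k
    rw [finrank_span_range_eq_rank _ (fun b : Fin (k + maxOrd f) × Fin n => (b.2, (b.1 : ℕ) + 1)),
      ← Matrix.rank_map_ringHom s ((jac σ f k).map (toKappa p))]
    · congr 1
      ext a b
      simp only [w, jac, Matrix.of_apply, Matrix.map_apply, hs, ← pderiv_shift_succ]
      rw [add_comm 1, Function.iterate_succ_apply']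
    · rintro b ⟨j, i⟩ hv
      simp only [w]
      rw [add_comm, Function.iterate_succ_apply']
      cases i with
      | zero => rw [pderiv_shift_zero, map_zero]
      | succ i =>
        have hv' : k + maxOrd f ≤ i := by
          by_contra hlt
          exact hv ⟨(⟨i, not_le.1 hlt⟩, j), rfl⟩
        have hb := b.1.2
        rw [pderiv_shift_succ, pderiv_eq_zero_of_mem_range
          (iterate_shift_mem_range σ f _ le_rfl) (by simp; omega), map_zero, map_zero]
  have hsup : W 0 (k + 2) = W 0 (k + 1) ⊔ W 1 (k + 1) := by
    refine le_antisymm (Submodule.span_le.2 ?_) (sup_le (Submodule.span_le.2 ?_)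
      (Submodule.span_le.2 ?_))
    · rintro _ ⟨⟨j, l⟩, rfl⟩
      by_cases hj : (j : ℕ) = 0
      · exact Submodule.mem_sup_left (Submodule.subset_span ⟨(⟨j, by omega⟩, l), rfl⟩)
      · refine Submodule.mem_sup_right (Submodule.subset_span ⟨(⟨j - 1, by omega⟩, l), ?_⟩)
        dsimp only
        congr 1
        omega
    · rintro _ ⟨⟨j, l⟩, rfl⟩
      exact Submodule.subset_span ⟨(⟨j, by omega⟩, l), rfl⟩
    · rintro _ ⟨⟨j, l⟩, rfl⟩
      exact Submodule.subset_span ⟨(⟨1 + j, by omega⟩, l), by simp only [zero_add]⟩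
  have hinf : W 1 k ≤ W 0 (k + 1) ⊓ W 1 (k + 1) := by
    refine le_inf (Submodule.span_le.2 ?_) (Submodule.span_le.2 ?_)
    · rintro _ ⟨⟨j, l⟩, rfl⟩
      exact Submodule.subset_span ⟨(⟨1 + j, by omega⟩, l), by simp only [zero_add]⟩
    · rintro _ ⟨⟨j, l⟩, rfl⟩
      exact Submodule.subset_span ⟨(⟨j, by omega⟩, l), rfl⟩
  have hfin : ∀ a k, FiniteDimensional (kappa p) (W a k) := fun a k =>
    FiniteDimensional.span_of_finite _ (Set.finite_range _)
  have := Submodule.finrank_sup_add_finrank_inf_eq (W 0 (k + 1)) (W 1 (k + 1))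
  have h2 := Submodule.finrank_mono hinf
  rw [← hsup, h0, h0, h1] at this
  rw [h1] at h2
  omega

end Shift

/-! ### Eventually linear functions and the numerical form of the theorem -/

section Arithmetic

/-- By concavity the increments of R are nonincreasing natural numbers, hence eventually a constant
c, and ψ has final slope n - c. -/
theorem exists_eventually_linear {n e : ℕ} {ψ R : ℕ → ℕ} (h : ∀ k, ψ k + R k = n * (k + e))
    (hR : Monotone R) (hR' : ∀ k, R (k + 2) + R k ≤ 2 * R (k + 1)) :
    ∃ (d : ℕ) (s : ℤ), ∀ᶠ k : ℕ in atTop, (ψ k : ℤ) = d * k + s := by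
  have hδ : Antitone fun k => R (k + 1) - R k := antitone_nat_of_succ_le fun k => by
    have h1 := hR' k
    have h2 : R k ≤ R (k + 1) := hR (Nat.le_succ k)
    have h3 : R (k + 1) ≤ R (k + 1 + 1) := hR (Nat.le_succ _)
    rw [show k + 1 + 1 = k + 2 from rfl] at h3 ⊢
    omega
  obtain ⟨N, hN⟩ := exists_forall_ge_eq_of_antitone hδ
  set c := R (N + 1) - R N
  have hstep : ∀ j : ℕ, (ψ (N + j) : ℤ) = ψ N + ((n : ℤ) - c) * j := by
    intro j
    induction j with
    | zero => simp
    | succ j ih =>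
      have h1 : R (N + j + 1) = R (N + j) + c := by
        have := hN (N + j) (Nat.le_add_right _ _)
        have h2 : R (N + j) ≤ R (N + j + 1) := hR (Nat.le_succ _)
        omega
      have h2 := h (N + j)
      have h3 := h (N + j + 1)
      rw [h1] at h3
      zify at h2 h3
      rw [← add_assoc]
      push_cast
      linarith
  -- A negative slope would make ψ negative at N + ψ(N) + 1.
  have hc : c ≤ n := by
    by_contra hlt
    have h1 := hstep (ψ N + 1)
    push_cast at h1
    nlinarith
  refine ⟨n - c, ψ N - ((n : ℤ) - c) * N, ?_⟩
  filter_upwards [eventually_ge_atTop N] with k hk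
  obtain ⟨j, rfl⟩ := Nat.exists_eq_add_of_le hk
  rw [hstep]
  push_cast [hc]
  ring

theorem eq_of_eventually_linear {ψ : ℕ → ℕ} {d d' : ℕ} {s s' : ℤ}
    (h : ∀ᶠ k : ℕ in atTop, (ψ k : ℤ) = d * k + s)
    (h' : ∀ᶠ k : ℕ in atTop, (ψ k : ℤ) = d' * k + s') : d = d' := by
  obtain ⟨N, hN⟩ := eventually_atTop.1 (h.and h')
  have h1 := hN N le_rfl
  have h2 := hN (N + 1) (Nat.le_succ N)
  push_cast at h2
  have : (d : ℤ) = d' := by linarith [h1.1, h1.2, h2.1, h2.2]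
  exact_mod_cast this

/-- In the range i - e + 1 + h ≥ ρ the quantity τ(i,h) + μ_h is affine in h with slope d + r - n.
Hence stability of τ(i,·) at its final value t(i) and linearity of μ with that slope are equivalent.
-/
theorem index_of_numerical {n r e : ℕ} {ψ μ : ℕ → ℕ} {τ : ℕ → ℕ → ℕ} {t : ℕ → ℕ} (he : 1 ≤ e)
    (hτ : ∀ i h, e ≤ i + 1 → (τ i h : ℤ) = ψ (i + 1 - e + h) + ((r : ℤ) - n) * h - μ h)
    (hex : ∀ i, e ≤ i + 1 → ∃ h, τ i h = t i)
    (hmono : ∀ i h h', e ≤ i + 1 → h ≤ h' → τ i h = t i → τ i h' = t i)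
    (hψ : ∃ (d : ℕ) (s : ℤ), ∀ᶠ k : ℕ in atTop, (ψ k : ℤ) = d * k + s) {ρ ω : ℕ}
    (hρ : ρ = sInf {k₀ : ℕ | ∃ (d : ℕ) (s : ℤ), (∀ᶠ k : ℕ in atTop, (ψ k : ℤ) = d * k + s) ∧
      ∀ k ≥ k₀, (ψ k : ℤ) = d * k + s})
    (hω : ω = sInf {k₀ : ℕ | ∃ (d : ℕ) (s a : ℤ),
      (∀ᶠ k : ℕ in atTop, (ψ k : ℤ) = d * k + s) ∧
      ∀ k ≥ k₀, (μ k : ℤ) = ((d : ℤ) + r - n) * k + a}) :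
    (∀ i, e ≤ i + 1 → ρ + e ≤ i + ω + 1 → τ i ω = t i) ∧
    ∀ i, e ≤ i + 1 → ∀ h, IsLeast {h | τ i h = t i} h → ρ + e ≤ i + ω + 1 → ρ + e ≤ i + h + 1 →
      ω = h := by
  obtain ⟨d, s, hds, hge⟩ := hρ ▸ Nat.sInf_mem (s := {k₀ : ℕ | ∃ (d : ℕ) (s : ℤ),
    (∀ᶠ k : ℕ in atTop, (ψ k : ℤ) = d * k + s) ∧ ∀ k ≥ k₀, (ψ k : ℤ) = d * k + s}) (by
      obtain ⟨d, s, h⟩ := hψ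
      obtain ⟨N, hN⟩ := eventually_atTop.1 h
      exact ⟨N, d, s, h, hN⟩)
  have key : ∀ i h, e ≤ i + 1 → ρ + e ≤ i + h + 1 → (τ i h : ℤ) =
      d * ((i + 1 - e : ℕ) : ℤ) + s + ((d : ℤ) + r - n) * h - μ h := by
    intro i h hi hih
    rw [hτ i h hi, hge _ (by omega)]
    push_cast
    ring
  have hμ : ∀ i h₀, e ≤ i + 1 → τ i h₀ = t i → ρ + e ≤ i + h₀ + 1 → ∀ h ≥ h₀, (μ h : ℤ) =
      ((d : ℤ) + r - n) * h + (d * ((i + 1 - e : ℕ) : ℤ) + s - t i) := by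
    intro i h₀ hi h0 hih h hh
    have h1 := key i h hi (by omega)
    rw [hmono i h₀ h hi hh h0] at h1
    linarith
  obtain ⟨d', s', a, hds', hμω⟩ := hω ▸ Nat.sInf_mem (s := {k₀ : ℕ | ∃ (d : ℕ) (s a : ℤ),
      (∀ᶠ k : ℕ in atTop, (ψ k : ℤ) = d * k + s) ∧
      ∀ k ≥ k₀, (μ k : ℤ) = ((d : ℤ) + r - n) * k + a}) (by
    obtain ⟨H, hH⟩ := hex (e - 1) (by omega)
    -- For i = e - 1 one has i - e + 1 + h = h, so adding ρ to a stable `H` reaches the range where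
    -- ψ is linear.
    exact ⟨H + ρ, d, s, _, hds, hμ (e - 1) (H + ρ) (by omega)
      (hmono _ _ _ (by omega) (Nat.le_add_right _ _) hH) (by omega)⟩)
  obtain rfl := eq_of_eventually_linear hds hds'
  have first : ∀ i, e ≤ i + 1 → ρ + e ≤ i + ω + 1 → τ i ω = t i := by
    intro i hi hiω
    obtain ⟨H, hH⟩ := hex i hi
    -- At this point both linear formulas for μ are valid, so their constants agree; the formula
    -- that starts at ω then gives τ(i,ω) = t(i).
    have h1 := hμ i (H + ρ + ω) hi (hmono _ _ _ hi (by omega) hH) (by omega) _ le_rfl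
    have h2 := hμω (H + ρ + ω) (by omega)
    have h3 := hμω ω le_rfl
    have h4 := key i ω hi hiω
    have : (τ i ω : ℤ) = t i := by linarith
    exact_mod_cast this
  refine ⟨first, fun i hi h hh hiω hih => le_antisymm ?_ (hh.2 (first i hi hiω))⟩
  rw [hω]
  exact Nat.sInf_le ⟨d, s, _, hds, hμ i h hi hh.1 hih⟩

end Arithmetic

/-! ### Transcendence degrees of the contractions of Δ_k to A_i -/

section Main

variable {K : Type*} [Field K] {n r : ℕ}

/-- Every element of `L` is a quotient of elements of the image of A_m, so `L` is algebraic over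
that image. -/
theorem trdeg_quotient_ker_eq_trdeg {K L : Type*} {n : ℕ} [Field K] [Field L] [Algebra K L]
    (φ : DiffPoly n K →+* L) (hC : ∀ c, φ (C c) = algebraMap K L c) (m : ℕ)
    (hL : ∀ z : L, ∃ a b : A n K m, φ (inclA m b) ≠ 0 ∧ φ (inclA m b) * z = φ (inclA m a)) :
    (Algebra.trdeg K (A n K m ⧸ RingHom.ker (φ.comp (inclA m)))).toNat =
      (Algebra.trdeg K L).toNat := by
  rw [trdeg_quotient_ker_eq φ hC le_rfl]
  set S := Algebra.adjoin K ((fun v : {v : Fin n × ℕ // v.2 ≤ m} => φ (X v.1)) '' {v | v.1.2 ≤ m})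
  have hS : ∀ a : A n K m, φ (inclA m a) ∈ S := by
    intro a
    rw [← aeval_eq_comp_inclA φ hC]
    have h : S = (aeval fun v : {v : Fin n × ℕ // v.2 ≤ m} => φ (X v.1)).range := by
      rw [← Algebra.adjoin_range_eq_range_aeval, ← Set.image_univ]
      have hu : {v : {v : Fin n × ℕ // v.2 ≤ m} | v.1.2 ≤ m} = Set.univ :=
        Set.eq_univ_of_forall fun v => v.2
      rw [← hu]
    rw [h]
    exact ⟨a, rfl⟩
  have halg : Algebra.IsAlgebraic S L := by
    refine ⟨fun z => ?_⟩
    obtain ⟨a, b, hb, h⟩ := hL z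
    have hz : z = φ (inclA m a) * (φ (inclA m b))⁻¹ := by
      rw [eq_mul_inv_iff_mul_eq₀ hb, mul_comm, h]
    rw [hz]
    exact (isAlgebraic_algebraMap (⟨_, hS a⟩ : S)).mul
      (isAlgebraic_algebraMap (⟨_, hS b⟩ : S)).inv
  have h1 := trdeg_add_eq K S (A := L)
  rw [trdeg_eq_zero (R := S) (A := L), add_zero] at h1
  rw [h1]

variable (σ : K →+* K) (f : Fin r → DiffPoly n K) (p : Ideal (DiffPoly n K)) [p.IsPrime]

theorem toKappaDelta_C (k : ℕ) (c : K) :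
    toKappaDelta σ f p k (C c) = algebraMap K (kappaDelta σ f p k) c := by
  have h : toA (n := n) (k + maxOrd f - 1) (C c) = algebraMap K (A n K (k + maxOrd f - 1)) c := by
    rw [← inclA_C (k + maxOrd f - 1), toA_inclA]
    rfl
  rw [IsScalarTower.algebraMap_apply K (B p (k + maxOrd f - 1)) (kappaDelta σ f p k),
    IsScalarTower.algebraMap_apply K (A n K (k + maxOrd f - 1)) (B p (k + maxOrd f - 1)), ← h]
  rfl

variable {σ f p} {hp : IsSigmaPrime (shift σ) p}

/-- For a quasi-prime system, `κ(Δ_k)` is a field. -/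
abbrev IsQuasiPrime.field (hF : IsQuasiPrime σ f p hp) (k : ℕ) : Field (kappaDelta σ f p k) :=
  have := hF.isDomain k
  FractionRing.field _

/-- For large s the rank over κ(Δ_{k+s}) is the rank over κ, and the constancy hypothesis carries
this back to s = 0. -/
theorem IsQuasiPrime.rank_map_toKappaDelta (hF : IsQuasiPrime σ f p hp) (he : 1 ≤ maxOrd f)
    (hmin : Minimal (fun q : Ideal (DiffPoly n K) => IsSigmaPrime (shift σ) q ∧
      sigmaSpan (shift σ) (Set.range f) ≤ q) p) {α β : Type*} [Fintype α] [Fintype β]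
    (M : Matrix α β (DiffPoly n K)) (k : ℕ) (hM : ∀ s, (M.map (toKappaDelta σ f p (k + s))).rank =
      (M.map (toKappaDelta σ f p k)).rank) :
    (M.map (toKappaDelta σ f p k)).rank = (M.map (toKappa p)).rank := by
  let _ := fun s => hF.field s
  have h := Matrix.eventually_rank_map_eq (toKappa p) (fun s => toKappaDelta σ f p s)
    exists_toKappa_mul_eq (fun g => by
      filter_upwards [hF.eventually_toKappaDelta_eq_zero_iff he hmin g] with s hs
      exact hs.trans (toKappa_eq_zero_iff p g).symm) M
  obtain ⟨N, hN⟩ := eventually_atTop.1 h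
  exact (hM N).symm.trans (hN (k + N) (Nat.le_add_left _ _))

theorem IsQuasiPrime.trdeg_add_rank [CharZero K] (hF : IsQuasiPrime σ f p hp)
    (he : 1 ≤ maxOrd f) {i h k : ℕ} (hi : maxOrd f ≤ i + 1) (hk : k = i + 1 - maxOrd f + h) :
    (Algebra.trdeg K (A n K i ⧸ RingHom.ker ((toKappaDelta σ f p k).comp (inclA i)))).toNat +
      ((jac σ f k).map (toKappaDelta σ f p k)).rank =
    n * (i + 1) + ((pseudoJac σ f h i).map (toKappaDelta σ f p k)).rank := by
  let _ := hF.field k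
  refine trdeg_add_rank_jac σ f (toKappaDelta σ f p k) (toKappaDelta_C σ f p k) hi hk
    (fun j hj l => toKappaDelta_iterate σ f p hj l) fun g hg hg0 => ?_
  obtain ⟨s, hs, hs', hsg⟩ := exists_mul_mem_span σ f p he hg hg0
  exact ⟨s, hs', toKappaDelta_ne_zero σ f p (hF.prime_delta k).ne_top hs hs', hsg⟩

theorem _root_.Matrix.rank_eq_zero_of_isEmpty {α β L : Type*} [Field L] [Fintype β] [IsEmpty β]
    (M : Matrix α β L) : M.rank = 0 :=
  Nat.le_zero.1 ((Matrix.rank_le_card_width M).trans (by simp))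

/-- The case h = 0, i = k + e - 1 of the Jacobian criterion, where the pseudo-Jacobian matrix has no
columns. -/
theorem IsQuasiPrime.psi_add_rank [CharZero K] (hF : IsQuasiPrime σ f p hp)
    (he : 1 ≤ maxOrd f) (k : ℕ) :
    psi σ f p k + ((jac σ f k).map (toKappaDelta σ f p k)).rank = n * (k + maxOrd f) := by
  let _ := hF.field k
  have h1 := hF.trdeg_add_rank he (i := k + maxOrd f - 1) (h := 0) (k := k) (by omega) (by omega)
  have h2 := trdeg_quotient_ker_eq_trdeg (toKappaDelta σ f p k) (toKappaDelta_C σ f p k)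
    (k + maxOrd f - 1) (exists_toKappaDelta_mul_eq σ f p k (hF.prime_delta k))
  have h3 : ((pseudoJac σ f 0 (k + maxOrd f - 1)).map (toKappaDelta σ f p k)).rank = 0 :=
    Matrix.rank_eq_zero_of_isEmpty _
  rw [h3, h2, Nat.sub_add_cancel (by omega), add_zero] at h1
  exact h1

/-- The Jacobian criteria for τ(i,h) and for ψ(k) contain the same rank of J_k over the same field
κ(Δ_k), which cancels. Only the pseudo-Jacobian rank must be moved to κ, where it equals hr - μ_h.
-/
theorem IsQuasiPrime.trdeg_eq [CharZero K] (hF : IsQuasiPrime σ f p hp) (he : 1 ≤ maxOrd f)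
    (hmin : Minimal (fun q : Ideal (DiffPoly n K) => IsSigmaPrime (shift σ) q ∧
      sigmaSpan (shift σ) (Set.range f) ≤ q) p)
    (hJ' : ∀ k i s : ℕ, maxOrd f ≤ i + 1 →
      ((pseudoJac σ f k i).map (toKappaDelta σ f p (i + 1 - maxOrd f + k + s))).rank =
        ((pseudoJac σ f k i).map (toKappaDelta σ f p (i + 1 - maxOrd f + k))).rank)
    (i h : ℕ) (hi : maxOrd f ≤ i + 1) :
    ((Algebra.trdeg K (A n K i ⧸ RingHom.ker
      ((toKappaDelta σ f p (i + 1 - maxOrd f + h)).comp (inclA i)))).toNat : ℤ) =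
    psi σ f p (i + 1 - maxOrd f + h) + ((r : ℤ) - n) * h - mu σ f p h := by
  have h1 := hF.trdeg_add_rank he hi (h := h) rfl
  have h2 := (hF.psi_add_rank he (i + 1 - maxOrd f + h)).trans (congrArg (n * ·)
    (show i + 1 - maxOrd f + h + maxOrd f = i + 1 + h by omega))
  have h3 := mu_add_rank f hp h he hi
  rw [hF.rank_map_toKappaDelta he hmin (pseudoJac σ f h i) _ fun s => hJ' h i s hi] at h1
  zify at h1 h2 h3
  linarith

/-- Ideals of B_i are determined by their contractions to A_i. -/
theorem deltaCap_eq_deltaInfCap_iff (hF : IsQuasiPrime σ f p hp) (he : 1 ≤ maxOrd f)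
    (hmin : Minimal (fun q : Ideal (DiffPoly n K) => IsSigmaPrime (shift σ) q ∧
      sigmaSpan (shift σ) (Set.range f) ≤ q) p) {i : ℕ} (hi : maxOrd f ≤ i + 1) (h : ℕ) :
    deltaCap σ f p i h = deltaInfCap σ f p hp i ↔
      RingHom.ker ((toKappaDelta σ f p (i + 1 - maxOrd f + h)).comp (inclA i)) =
        p.comap (inclA i) := by
  have h1 : (deltaCap σ f p i h).comap (algebraMap (A n K i) (B p i)) =
      RingHom.ker ((toKappaDelta σ f p (i + 1 - maxOrd f + h)).comp (inclA i)) := by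
    ext a
    rw [RingHom.mem_ker, RingHom.comp_apply, toKappaDelta_eq_zero_iff σ f p (m := i + h) (by omega),
      toA_inclA_of_le (Nat.le_add_right i h), Ideal.mem_comap, deltaCap, Ideal.mem_comap, transB,
      Localization.localRingHom_to_map]
  have h2 : (deltaInfCap σ f p hp i).comap (algebraMap (A n K i) (B p i)) =
      p.comap (inclA i) := by
    conv_rhs => rw [← hF.comap_DeltaInf he hmin]
    ext a
    rw [Ideal.mem_comap, deltaInfCap, Ideal.mem_comap, inclB, Localization.localRingHom_to_map,
      Ideal.mem_comap, Ideal.mem_comap]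
  refine ⟨fun h => h1.symm.trans ((congrArg _ h).trans h2), fun h' => ?_⟩
  have h12 := h1.trans (h'.trans h2.symm)
  exact ((IsLocalization.map_under (p.comap (inclA i)).primeCompl (B p i) _).symm.trans
    (congrArg (Ideal.map _) h12)).trans
    (IsLocalization.map_under (p.comap (inclA i)).primeCompl (B p i) _)

theorem IsQuasiPrime.ker_mono (hF : IsQuasiPrime σ f p hp) (he : 1 ≤ maxOrd f) {i k k' : ℕ}
    (hi : i + 1 ≤ k + maxOrd f) (hk : k ≤ k') :
    RingHom.ker ((toKappaDelta σ f p k).comp (inclA i)) ≤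
      RingHom.ker ((toKappaDelta σ f p k').comp (inclA i)) := fun a ha =>
  hF.toKappaDelta_mono he hk (range_inclA_mono (by omega) ⟨a, rfl⟩) ha

/-- The threshold of `eventually_toKappaDelta_eq_zero_iff` depends on the element, but `p ∩ A_i` is
finitely generated. -/
theorem IsQuasiPrime.eventually_ker_eq (hF : IsQuasiPrime σ f p hp)
    (he : 1 ≤ maxOrd f)
    (hmin : Minimal (fun q : Ideal (DiffPoly n K) => IsSigmaPrime (shift σ) q ∧
      sigmaSpan (shift σ) (Set.range f) ≤ q) p) (i : ℕ) :
    ∀ᶠ k in atTop, p.comap (inclA i) ≤ RingHom.ker ((toKappaDelta σ f p k).comp (inclA i)) := by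
  have : Finite {v : Fin n × ℕ // v.2 ≤ i} := .of_equiv _ (varEquiv n rfl)
  obtain ⟨S, hS⟩ := IsNoetherian.noetherian (p.comap (inclA (n := n) (K := K) i))
  have h : ∀ᶠ k in atTop, ∀ a ∈ S, toKappaDelta σ f p k (inclA i a) = 0 := by
    rw [Filter.eventually_all_finset]
    intro a ha
    have ha' : inclA i a ∈ p := by
      have : a ∈ p.comap (inclA i) := by rw [← hS]; exact Submodule.subset_span ha
      exact this
    filter_upwards [hF.eventually_toKappaDelta_eq_zero_iff he hmin (inclA i a)] with k hk
    exact hk.2 ha'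
  filter_upwards [h] with k hk
  rw [← hS]
  exact Submodule.span_le.2 fun a ha => hk a ha

theorem IsQuasiPrime.ker_le (hF : IsQuasiPrime σ f p hp) (he : 1 ≤ maxOrd f)
    (hmin : Minimal (fun q : Ideal (DiffPoly n K) => IsSigmaPrime (shift σ) q ∧
      sigmaSpan (shift σ) (Set.range f) ≤ q) p) {i k : ℕ} (hi : i + 1 ≤ k + maxOrd f) :
    RingHom.ker ((toKappaDelta σ f p k).comp (inclA i)) ≤ p.comap (inclA i) := by
  intro a ha
  obtain ⟨k', hk', hkk'⟩ := ((hF.eventually_toKappaDelta_eq_zero_iff he hmin (inclA i a)).and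
    (eventually_ge_atTop k)).exists
  exact hk'.1 (hF.ker_mono he hi hkk' ha)

theorem IsQuasiPrime.ker_isPrime (hF : IsQuasiPrime σ f p hp) (i k : ℕ) :
    (RingHom.ker ((toKappaDelta σ f p k).comp (inclA i))).IsPrime := by
  have := hF.isDomain k
  exact RingHom.ker_isPrime _

theorem rank_jac_mono (σ : K →+* K) (f : Fin r → DiffPoly n K) (p : Ideal (DiffPoly n K))
    [p.IsPrime] : Monotone fun k => ((jac σ f k).map (toKappa p)).rank := by
  refine monotone_nat_of_le_succ fun k => ?_
  exact Matrix.rank_submatrix_le ((jac σ f (k + 1)).map (toKappa p))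
    (fun a : Fin k × Fin r => (a.1.castSucc, a.2))
    (fun b : Fin (k + maxOrd f) × Fin n => (⟨b.1, by have := b.1.2; omega⟩, b.2))

end Main

end DiffSys

end

/-! ### The main theorem -/

theorem mainTheorem3 {K : Type*} [Field K] [CharZero K] (σ : K →+* K) {n r : ℕ}
    (f : Fin r → DiffSys.DiffPoly n K)
    (p : Ideal (DiffSys.DiffPoly n K)) [p.IsPrime]
    (hp : DiffSys.IsSigmaPrime (DiffSys.shift σ) p)
    -- `p` is minimal among the `σ`-prime ideals that contain `[F]`
    (hmin : Minimal (fun q : Ideal (DiffSys.DiffPoly n K) =>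
      DiffSys.IsSigmaPrime (DiffSys.shift σ) q ∧
        DiffSys.sigmaSpan (DiffSys.shift σ) (Set.range f) ≤ q) p)
    -- the system has order `e ≥ 1`
    (he : 1 ≤ DiffSys.maxOrd f)
    (hF : DiffSys.IsQuasiPrime σ f p hp)
    -- the rank of `J_k` over `κ(Δ_{k+s})` does not depend on `s`
    (hJ : ∀ k s : ℕ,
      ((DiffSys.jac σ f k).map (DiffSys.toKappaDelta σ f p (k + s))).rank =
        ((DiffSys.jac σ f k).map (DiffSys.toKappaDelta σ f p k)).rank)
    -- the rank of `J_{k,i}` over `κ(Δ_{i-e+1+k+s})` does not depend on `s`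
    (hJ' : ∀ k i s : ℕ, DiffSys.maxOrd f ≤ i + 1 →
      ((DiffSys.pseudoJac σ f k i).map
          (DiffSys.toKappaDelta σ f p (i + 1 - DiffSys.maxOrd f + k + s))).rank =
        ((DiffSys.pseudoJac σ f k i).map
          (DiffSys.toKappaDelta σ f p (i + 1 - DiffSys.maxOrd f + k))).rank) :
    (∀ i : ℕ, DiffSys.maxOrd f ≤ i + 1 →
      DiffSys.rho σ f p + DiffSys.maxOrd f ≤ i + DiffSys.omega σ f p + 1 →
        DiffSys.deltaCap σ f p i (DiffSys.omega σ f p) = DiffSys.deltaInfCap σ f p hp i) ∧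
    (∀ i : ℕ, DiffSys.maxOrd f ≤ i + 1 →
      ∃ h : ℕ, IsLeast (DiffSys.indexSet σ f p hp i) h ∧
        (DiffSys.rho σ f p + DiffSys.maxOrd f ≤ i + DiffSys.omega σ f p + 1 →
          DiffSys.rho σ f p + DiffSys.maxOrd f ≤ i + h + 1 →
            DiffSys.omega σ f p = h)) := by
  let t : ℕ → ℕ := fun i =>
    (Algebra.trdeg K (DiffSys.A n K i ⧸ p.comap (DiffSys.inclA i))).toNat
  let τ : ℕ → ℕ → ℕ := fun i h => (Algebra.trdeg K (DiffSys.A n K i ⧸ RingHom.ker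
    ((DiffSys.toKappaDelta σ f p (i + 1 - DiffSys.maxOrd f + h)).comp
      (DiffSys.inclA i)))).toNat
  -- The two primes of A_i are nested, so they coincide as soon as their quotients have the same
  -- transcendence degree.
  have hiff : ∀ i h, DiffSys.maxOrd f ≤ i + 1 →
      (DiffSys.deltaCap σ f p i h = DiffSys.deltaInfCap σ f p hp i ↔ τ i h = t i) := by
    intro i h hi
    rw [DiffSys.deltaCap_eq_deltaInfCap_iff hF he hmin hi]
    refine ⟨fun h' => congrArg (fun I : Ideal (DiffSys.A n K i) =>
      (Algebra.trdeg K (DiffSys.A n K i ⧸ I)).toNat) h', fun h' => ?_⟩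
    have := hF.ker_isPrime i (i + 1 - DiffSys.maxOrd f + h)
    have : Finite {v : Fin n × ℕ // v.2 ≤ i} := .of_equiv _ (DiffSys.varEquiv n rfl)
    exact MvPolynomial.ideal_eq_of_trdeg_le (hF.ker_le he hmin (by omega)) h'.le
  have hmono : ∀ i h h', DiffSys.maxOrd f ≤ i + 1 → h ≤ h' → τ i h = t i → τ i h' = t i := by
    intro i h h' hi hh hτ
    rw [← hiff i _ hi, DiffSys.deltaCap_eq_deltaInfCap_iff hF he hmin hi] at hτ ⊢
    refine le_antisymm (hF.ker_le he hmin (by omega)) ?_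
    rw [← hτ]
    exact hF.ker_mono he (by omega) (by omega)
  have hex : ∀ i, DiffSys.maxOrd f ≤ i + 1 → ∃ h, τ i h = t i := by
    intro i hi
    obtain ⟨N, hN⟩ := Filter.eventually_atTop.1 (hF.eventually_ker_eq he hmin i)
    refine ⟨N, ?_⟩
    rw [← hiff i _ hi, DiffSys.deltaCap_eq_deltaInfCap_iff hF he hmin hi]
    exact le_antisymm (hF.ker_le he hmin (by omega)) (hN _ (by omega))
  -- Constancy of the ranks of J_k is needed here: concavity is available over κ, whereas ψ(k) is
  -- governed by the rank over κ(Δ_k).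
  have hψ := DiffSys.exists_eventually_linear (n := n) (e := DiffSys.maxOrd f)
    (ψ := DiffSys.psi σ f p)
    (R := fun k => ((DiffSys.jac σ f k).map (DiffSys.toKappa p)).rank)
    (fun k => by
      rw [← hF.psi_add_rank he k, hF.rank_map_toKappaDelta he hmin _ k (hJ k)])
    (DiffSys.rank_jac_mono σ f p) (DiffSys.rank_jac_concave f hp)
  obtain ⟨h1, h2⟩ := DiffSys.index_of_numerical (μ := DiffSys.mu σ f p) he
    (hF.trdeg_eq he hmin hJ') hex hmono hψ (ρ := DiffSys.rho σ f p) (ω := DiffSys.omega σ f p)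
    rfl rfl
  refine ⟨fun i hi hiω => (hiff i _ hi).2 (h1 i hi hiω), fun i hi => ?_⟩
  have hset : DiffSys.indexSet σ f p hp i = {h | τ i h = t i} := Set.ext fun h => hiff i h hi
  rw [hset]
  have hle : IsLeast {h | τ i h = t i} (sInf {h | τ i h = t i}) :=
    ⟨Nat.sInf_mem (hex i hi), fun _ h => Nat.sInf_le h⟩
  exact ⟨_, hle, h2 i hi _ hle⟩
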